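/- Let $G$ be a compact Lie group (finite-dimensional, of class $C^\infty$) with a left-invariant Riemannian metric $g$, and let $\mathrm{Ric}$ be the Ricci tensor of $g$. Let $X$ be a smooth vector field on $G$, not assumed to be invariant, and let $m\in(0,\infty)$ and $\lambda\in\mathbb{R}$ be constants such that $$\mathrm{Ric}+\tfrac12\,\mathcal{L}_Xg-\tfrac1m\,X^*\otimes X^*=\lambda g ,$$ where $\mathcal{L}_Xg$ is the Lie derivative of $g$ along $X$ and $X^*=g(X,\cdot)$ (that is, $g$ is $m$-quasi-Einstein with vector field $X$). Then $X$ is a Killing vector field, i.e. $\mathcal{L}_Xg=0$, and, if $G$ is connected, $X$ is left-invariant. Without connectedness, $X$ is still a Killing field and is invariant under the left translations by all elements of the identity component of $G$. -/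

import Mathlib

open scoped Manifold ContDiff

noncomputable section

namespace QuasiEinstein

section Riemannian

variable {E : Type*} [NormedAddCommGroup E] [NormedSpace ℝ E]
  {H : Type*} [TopologicalSpace H] {I : ModelWithCorners ℝ E H}
  {M : Type*} [TopologicalSpace M] [ChartedSpace H M] [IsManifold I ∞ M]

variable (I M) in
/-- A smooth Riemannian metric on the manifold `M`. -/
abbrev Metric := Bundle.ContMDiffRiemannianMetric I ∞ E (fun x : M ↦ TangentSpace I x)

variable (I) in
/-- Smooth (`C^∞`) vector fields. -/
def IsSmoothField (X : Π x : M, TangentSpace I x) : Prop :=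
  ContMDiff I I.tangent ∞ (fun x ↦ (⟨x, X x⟩ : TangentBundle I M))

/-- The function `g(Y, Z)`. -/
def pair (g : Metric I M) (Y Z : Π x : M, TangentSpace I x) (x : M) : ℝ :=
  g.inner x (Y x) (Z x)

variable (g : Metric I M)

lemma mdifferentiableAt_pair {Y Z : Π x : M, TangentSpace I x} {x : M}
    (hY : MDiffAt (T% Y) x) (hZ : MDiffAt (T% Z) x) : MDiffAt (pair g Y Z) x := by
  have : MDifferentiableAt I (I.prod 𝓘(ℝ))
      (fun m ↦ Bundle.TotalSpace.mk' ℝ (E := Bundle.Trivial M ℝ) m (g.inner m (Y m) (Z m))) x := by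
    apply MDifferentiableAt.clm_bundle_apply₂ (F₁ := E) (F₂ := E) (b := id)
    · exact g.contMDiff.mdifferentiableAt (by simp)
    · exact hY
    · exact hZ
  simp only [mdifferentiableAt_totalSpace] at this
  exact this.2

/-- The right-hand side of Koszul's formula, `X g(Y, Z) + Y g(Z, X) - Z g(X, Y) + g([X, Y], Z)
- g([X, Z], Y) - g([Y, Z], X)`. -/
def koszul (X Y Z : Π x : M, TangentSpace I x) (x : M) : ℝ :=
  mvfderiv I (pair g Y Z) x (X x) + mvfderiv I (pair g Z X) x (Y x)
    - mvfderiv I (pair g X Y) x (Z x)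
    + g.inner x (VectorField.mlieBracket I X Y x) (Z x)
    - g.inner x (VectorField.mlieBracket I X Z x) (Y x)
    - g.inner x (VectorField.mlieBracket I Y Z x) (X x)

lemma pair_comm (Y Z : Π x : M, TangentSpace I x) : pair g Y Z = pair g Z Y := by
  ext x; exact g.symm ..

lemma pair_add_left (Y Y' Z : Π x : M, TangentSpace I x) :
    pair g (Y + Y') Z = pair g Y Z + pair g Y' Z := by
  ext x; simp [pair]

lemma pair_smul_left (f : M → ℝ) (Y Z : Π x : M, TangentSpace I x) :
    pair g (f • Y) Z = f * pair g Y Z := by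
  ext x; simp [pair]

lemma pair_add_right (Y Z Z' : Π x : M, TangentSpace I x) :
    pair g Y (Z + Z') = pair g Y Z + pair g Y Z' := by
  ext x; simp [pair]

lemma pair_smul_right (f : M → ℝ) (Y Z : Π x : M, TangentSpace I x) :
    pair g Y (f • Z) = f * pair g Y Z := by
  ext x; simp [pair]

variable [FiniteDimensional ℝ E]

open VectorField

lemma koszul_tensorial_left {x : M} {Y Z : Π x : M, TangentSpace I x}
    (hY : MDiffAt (T% Y) x) (hZ : MDiffAt (T% Z) x) :
    TensorialAt I E (fun X ↦ koszul g X Y Z x) x where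
  smul {f X} hf hX := by
    have := FiniteDimensional.complete ℝ E
    simp only [koszul, pair_smul_left, pair_smul_right,
      mvfderiv_mul hf (mdifferentiableAt_pair g hX hY),
      mvfderiv_mul hf (mdifferentiableAt_pair g hZ hX),
      mlieBracket_smul_left hf hX]
    simp [pair, g.symm x (Z x) (X x)]
    ring
  add {X X'} hX hX' := by
    have := FiniteDimensional.complete ℝ E
    simp only [koszul, pair_add_left, pair_add_right,
      mvfderiv_add (mdifferentiableAt_pair g hX hY) (mdifferentiableAt_pair g hX' hY),
      mvfderiv_add (mdifferentiableAt_pair g hZ hX) (mdifferentiableAt_pair g hZ hX'),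
      mlieBracket_add_left hX hX']
    simp
    ring

lemma koszul_tensorial_right {x : M} {X Y : Π x : M, TangentSpace I x}
    (hX : MDiffAt (T% X) x) (hY : MDiffAt (T% Y) x) :
    TensorialAt I E (fun Z ↦ koszul g X Y Z x) x where
  smul {f Z} hf hZ := by
    have := FiniteDimensional.complete ℝ E
    simp only [koszul, pair_smul_left, pair_smul_right,
      mvfderiv_mul hf (mdifferentiableAt_pair g hY hZ),
      mvfderiv_mul hf (mdifferentiableAt_pair g hZ hX),
      mlieBracket_smul_right hf hZ]
    simp [pair, g.symm x (Z x) (X x), g.symm x (Z x) (Y x)]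
    ring
  add {Z Z'} hZ hZ' := by
    have := FiniteDimensional.complete ℝ E
    simp only [koszul, pair_add_left, pair_add_right,
      mvfderiv_add (mdifferentiableAt_pair g hY hZ) (mdifferentiableAt_pair g hY hZ'),
      mvfderiv_add (mdifferentiableAt_pair g hZ hX) (mdifferentiableAt_pair g hZ' hX),
      mlieBracket_add_right hZ hZ']
    simp
    ring

lemma inner_isInvertible (x : M) : (g.inner x).IsInvertible := by
  have : FiniteDimensional ℝ (TangentSpace I x) := inferInstanceAs (FiniteDimensional ℝ E)
  have : T2Space (TangentSpace I x) := inferInstanceAs (T2Space E)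
  have hinj : Function.Injective (g.inner x) := by
    rw [injective_iff_map_eq_zero]
    intro v hv
    by_contra h
    have := g.pos x v h
    simp [hv] at this
  let φ : TangentSpace I x →ₗ[ℝ] (TangentSpace I x →L[ℝ] ℝ) := (g.inner x).toLinearMap
  have hrank : Module.finrank ℝ (TangentSpace I x) =
      Module.finrank ℝ (TangentSpace I x →L[ℝ] ℝ) := by
    rw [← (LinearMap.toContinuousLinearMap (𝕜 := ℝ) (E := TangentSpace I x)
      (F' := ℝ)).finrank_eq, Subspace.dual_finrank_eq]
  let e := (LinearEquiv.ofInjectiveOfFinrankEq φ hinj hrank).toContinuousLinearEquiv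
  refine ⟨e, ?_⟩
  ext v w
  rfl

open Classical in
/-- `∇Y` at `x`: the linear map `v ↦ ∇_v Y` on the tangent space at `x` which is determined by
Koszul's formula `2 g(∇_X Y, Z) = koszul g X Y Z` (junk value `0` if `Y` is not differentiable
at `x`). -/
def leviCivitaAux (Y : Π x : M, TangentSpace I x) (x : M) :
    TangentSpace I x →L[ℝ] TangentSpace I x :=
  if hY : MDiffAt (T% Y) x then
    (g.inner x).inverse ∘L ((1 / 2 : ℝ) • TensorialAt.mkHom₂ (fun X Z ↦ koszul g X Y Z x) x
      (fun _ hZ ↦ koszul_tensorial_left g hY hZ) (fun _ hX ↦ koszul_tensorial_right g hX hY))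
  else 0

lemma inner_leviCivitaAux {X Y Z : Π x : M, TangentSpace I x} {x : M} (hX : MDiffAt (T% X) x)
    (hY : MDiffAt (T% Y) x) (hZ : MDiffAt (T% Z) x) :
    g.inner x (leviCivitaAux g Y x (X x)) (Z x) = 1 / 2 * koszul g X Y Z x := by
  rw [leviCivitaAux, dif_pos hY]
  simp only [ContinuousLinearMap.comp_apply, (inner_isInvertible g x).self_apply_inverse]
  simp [TensorialAt.mkHom₂_apply _ _ hX hZ]

lemma eq_of_inner_eq {x : M} {A B : TangentSpace I x →L[ℝ] TangentSpace I x}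
    (h : ∀ X Z : Π x : M, TangentSpace I x, MDiffAt (T% X) x → MDiffAt (T% Z) x →
      g.inner x (A (X x)) (Z x) = g.inner x (B (X x)) (Z x)) : A = B := by
  ext v
  apply (inner_isInvertible g x).injective
  ext w
  simpa using h (FiberBundle.extend E v) (FiberBundle.extend E w)
    (FiberBundle.mdifferentiableAt_extend ..) (FiberBundle.mdifferentiableAt_extend ..)

/-- The Levi-Civita connection of `g`; `leviCivita g Y x (X x)` is `∇_X Y` at `x`. The two lemmas
below say that it is torsion-free and compatible with `g`. -/
def leviCivita : CovariantDerivative I E (TangentSpace I : M → Type _) where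
  toFun := leviCivitaAux g
  isCovariantDerivativeOnUniv :=
  { add := by
      intro Y Y' x hY hY' _
      have := FiniteDimensional.complete ℝ E
      refine eq_of_inner_eq g fun X Z hX hZ ↦ ?_
      rw [inner_leviCivitaAux g hX (mdifferentiableAt_add_section hY hY') hZ]
      simp only [add_apply, map_add, inner_leviCivitaAux g hX hY hZ,
        inner_leviCivitaAux g hX hY' hZ]
      simp only [koszul, pair_add_left, pair_add_right,
        mvfderiv_add (mdifferentiableAt_pair g hY hZ) (mdifferentiableAt_pair g hY' hZ),
        mvfderiv_add (mdifferentiableAt_pair g hX hY) (mdifferentiableAt_pair g hX hY'),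
        mlieBracket_add_right hY hY', mlieBracket_add_left hY hY']
      simp
      ring
    leibniz := by
      intro Y f x hY hf _
      have := FiniteDimensional.complete ℝ E
      refine eq_of_inner_eq g fun X Z hX hZ ↦ ?_
      rw [inner_leviCivitaAux g hX (hf.smul_section hY) hZ]
      simp only [add_apply, map_add, smul_apply,
        map_smul, inner_leviCivitaAux g hX hY hZ, ContinuousLinearMap.smulRight_apply]
      simp only [koszul, pair_smul_left, pair_smul_right,
        mvfderiv_mul hf (mdifferentiableAt_pair g hY hZ),
        mvfderiv_mul hf (mdifferentiableAt_pair g hX hY),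
        mlieBracket_smul_right hf hY, mlieBracket_smul_left hf hY]
      simp [pair, g.symm x (Y x) (X x)]
      ring }

/-- Torsion-freeness. -/
lemma leviCivita_torsion {X Y : Π x : M, TangentSpace I x} {x : M} (hX : MDiffAt (T% X) x)
    (hY : MDiffAt (T% Y) x) :
    leviCivita g Y x (X x) - leviCivita g X x (Y x) = mlieBracket I X Y x := by
  apply (inner_isInvertible g x).injective
  ext w
  have hw := FiberBundle.mdifferentiableAt_extend I E w
  have h1 := inner_leviCivitaAux g hX hY hw
  have h2 := inner_leviCivitaAux g hY hX hw
  simp only [FiberBundle.extend_apply_self] at h1 h2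
  change g.inner x (leviCivitaAux g Y x (X x) - leviCivitaAux g X x (Y x)) w = _
  rw [map_sub, sub_apply, h1, h2]
  simp only [koszul, mlieBracket_swap_apply (V := Y) (W := X), pair_comm g Y X,
    pair_comm g Y, pair_comm g X (FiberBundle.extend E w)]
  simp
  ring

/-- Compatibility with the metric. -/
lemma leviCivita_metric {X Y Z : Π x : M, TangentSpace I x} {x : M} (hX : MDiffAt (T% X) x)
    (hY : MDiffAt (T% Y) x) (hZ : MDiffAt (T% Z) x) :
    mvfderiv I (pair g Y Z) x (X x) =
      g.inner x (leviCivita g Y x (X x)) (Z x) + g.inner x (Y x) (leviCivita g Z x (X x)) := by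
  have h1 := inner_leviCivitaAux g hX hY hZ
  have h2 := inner_leviCivitaAux g hX hZ hY
  change _ = g.inner x (leviCivitaAux g Y x (X x)) (Z x) +
    g.inner x (Y x) (leviCivitaAux g Z x (X x))
  rw [g.symm x (Y x), h1, h2]
  simp only [koszul, mlieBracket_swap_apply (V := Z) (W := Y), pair_comm g Z Y,
    pair_comm g Y X, pair_comm g Z X]
  simp
  ring

/-- The curvature `R(X, Y)Z = ∇_X ∇_Y Z - ∇_Y ∇_X Z - ∇_[X,Y] Z` (recall that
`leviCivita g Z y (Y y)` is `∇_Y Z` at `y`). -/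
def curvature (X Y Z : Π x : M, TangentSpace I x) (x : M) : TangentSpace I x :=
  leviCivita g (fun y ↦ leviCivita g Z y (Y y)) x (X x)
    - leviCivita g (fun y ↦ leviCivita g Z y (X y)) x (Y x)
    - leviCivita g Z x (mlieBracket I X Y x)

/-- The Ricci curvature `Ric(Y, Z)` at `x`: the trace of the endomorphism `v ↦ R(v, Y)Z` of the
tangent space at `x`, computed in a basis. A tangent vector `v` is put into the first slot of `R`
through `FiberBundle.extend E v`, a vector field which is smooth near `x` with value `v` at `x`. -/
def ricci (Y Z : Π x : M, TangentSpace I x) (x : M) : ℝ :=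
  haveI : FiniteDimensional ℝ (TangentSpace I x) := inferInstanceAs (FiniteDimensional ℝ E)
  letI b := Module.finBasis ℝ (TangentSpace I x)
  ∑ i, b.coord i (curvature g (FiberBundle.extend E (b i)) Y Z x)

/-- The Lie derivative of the metric,
`(L_X g)(Y, Z) = X(g(Y, Z)) - g([X, Y], Z) - g(Y, [X, Z])`. -/
def lieDerivMetric (X Y Z : Π x : M, TangentSpace I x) (x : M) : ℝ :=
  mvfderiv I (pair g Y Z) x (X x) - g.inner x (mlieBracket I X Y x) (Z x)
    - g.inner x (Y x) (mlieBracket I X Z x)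

/-- `X` is a Killing field: `L_X g = 0`. -/
def IsKilling (X : Π x : M, TangentSpace I x) : Prop :=
  ∀ Y Z : Π x : M, TangentSpace I x, IsSmoothField I Y → IsSmoothField I Z →
    ∀ x, lieDerivMetric g X Y Z x = 0

/-- `Ric + ½ L_X g - (1/m) X* ⊗ X* = c g` as an identity of symmetric 2-tensors, where
`X*` is the 1-form `g(X, ·)`; this is meant for `m ≠ 0`. -/
def IsQuasiEinstein (m c : ℝ) (X : Π x : M, TangentSpace I x) : Prop :=
  ∀ Y Z : Π x : M, TangentSpace I x, IsSmoothField I Y → IsSmoothField I Z → ∀ x,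
    ricci g Y Z x + 1 / 2 * lieDerivMetric g X Y Z x - 1 / m * (pair g X Y x * pair g X Z x)
      = c * pair g Y Z x

end Riemannian

section LieGroup

variable {E : Type*} [NormedAddCommGroup E] [NormedSpace ℝ E]
  {H : Type*} [TopologicalSpace H] {I : ModelWithCorners ℝ E H}
  {G : Type*} [TopologicalSpace G] [ChartedSpace H G] [Group G]

/-- The metric `g` is left-invariant: every left translation is an isometry. -/
def IsLeftInvariantMetric [IsManifold I ∞ G] (g : Metric I G) : Prop :=
  ∀ (a x : G) (v w : TangentSpace I x),
    g.inner (a * x) (mfderiv I I (fun y ↦ a * y) x v) (mfderiv I I (fun y ↦ a * y) x w)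
      = g.inner x v w

/-- The vector field `X` is invariant under the left translation by `a`. -/
def IsInvariantUnderLeft (a : G) (X : Π x : G, TangentSpace I x) : Prop :=
  ∀ x : G, mfderiv I I (fun y ↦ a * y) x (X x) = X (a * x)

/-- The vector field `X` is left-invariant. -/
def IsLeftInvariantField (X : Π x : G, TangentSpace I x) : Prop :=
  ∀ a : G, IsInvariantUnderLeft a X

end LieGroup

end QuasiEinstein

end

/-! The argument is a Bochner-type integration in a left-invariant orthonormal frame `e_i`. Write
`f_i = g(X, e_i)`, `a_ij = e_i(f_j)`, `K = ½ L_X g`, `D = ∑ a_ii` and `N = |X|²`. The Ricci tensor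
has constant components `r_ij` in this frame, so the equation becomes `r_ij + K_ij - f_i f_j / m = λ
δ_ij`.

Its trace gives `N = m (D + κ)` with `κ` constant. Contracting it with `K` gives `|K|² = λ D + K(X,
X) / m - ⟨r, K⟩`. Here `K(X, X) = ∑ f_i f_j a_ij`, and `div(N X) = D N + 2 K(X, X)`. Eliminating `N`
and `K(X, X)` yields `|K|² + D²/2 = -∑ r_ij a_ij + (λ - κ/2) D + div(N X) / (2m)`. Every term on the
right is a sum of derivatives along the `e_i` with constant coefficients, so it integrates to zero
against Haar measure. The left side is a sum of squares, hence `K = 0`.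

The replacement of `⟨r, K⟩` by `∑ r_ij a_ij` is the algebraic core: the structure-constant terms of
`K` pair to zero with `r` because the Ricci form of a unimodular metric Lie algebra is orthogonal to
every `ad` (`sum_frameRicci_mul_eq_zero`). Unimodularity comes from compactness
(`sum_structConst_eq_zero`), and the integrated identity is `lieDeriv_frame_eq_zero`.

Once `K = 0`, the diagonal equations say that each `f_i²` is constant. By continuity each `f_i` is
then constant on connected sets, which is left-invariance under the identity component. -/

noncomputable section

namespace QuasiEinstein

/-! ### Ricci curvature of a unimodular metric Lie algebra -/

section StructureConstants

variable {ι : Type*} [Fintype ι]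

/-- The Christoffel symbols of a left-invariant metric in a left-invariant orthonormal frame with
structure constants `c`. -/
def frameChristoffel (c : ι → ι → ι → ℝ) (i j k : ι) : ℝ := (c i j k - c i k j - c j k i) / 2

/-- The Ricci curvature of a left-invariant metric in a left-invariant orthonormal frame with
structure constants `c`. -/
def frameRicci (c : ι → ι → ι → ℝ) (a b : ι) : ℝ :=
  ∑ k, ∑ l, (frameChristoffel c a b l * frameChristoffel c k l k
    - frameChristoffel c k b l * frameChristoffel c a l k - c k a l * frameChristoffel c l b k)

/-- Unimodularity kills the term with `Γ_klk = -c_lkk`; what remains agrees with the right side up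
to relabelling `k` and `l`. In this form each term is a trace of products of `ad` matrices. -/
lemma frameRicci_eq {c : ι → ι → ι → ℝ} (hanti : ∀ i j k, c i j k = -c j i k)
    (htr : ∀ i, ∑ k, c i k k = 0) (a b : ι) : frameRicci c a b =
    ∑ k, ∑ l, (-(1 / 2) * (c a k l * c b k l) - 1 / 2 * (c a k l * c b l k)
      + 1 / 4 * (c k l a * c k l b)) := by
  have h0 : ∑ k, ∑ l, frameChristoffel c a b l * frameChristoffel c k l k = 0 := by
    rw [Finset.sum_comm]
    refine Finset.sum_eq_zero fun l _ ↦ ?_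
    have hz : ∀ k, c k k l = 0 := fun k ↦ by linarith [hanti k k l]
    have : ∀ k, frameChristoffel c k l k = -c l k k := fun k ↦ by
      rw [frameChristoffel, hanti k l k, hz]; ring
    simp [this, ← Finset.mul_sum, htr]
  have hs : ∀ P : ι → ι → ℝ, ∑ k, ∑ l, (P k l - P l k) = 0 := fun P ↦ by
    simp only [Finset.sum_sub_distrib]
    rw [Finset.sum_comm, sub_self]
  -- Chosen so that the two summands differ exactly by `P k l - P l k`, which turns the equality of
  -- sums into a termwise identity.
  have key := hs fun k l ↦ (1 / 4) * ((c b k l + c b l k) * c a l k + c b k l * c k l a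
    + c a k l * c k l b)
  rw [← add_zero (∑ k, _), ← h0, ← add_zero (_ + _), ← key, frameRicci]
  simp only [← Finset.sum_add_distrib]
  refine Finset.sum_congr rfl fun k _ ↦ Finset.sum_congr rfl fun l _ ↦ ?_
  simp only [frameChristoffel, hanti k b l, hanti l b k, hanti k a l, hanti l k a,
    hanti l k b]
  ring

lemma sum_four_comm (F : ι → ι → ι → ι → ℝ) :
    ∑ a, ∑ b, ∑ k, ∑ l, F a b k l = ∑ k, ∑ l, ∑ a, ∑ b, F a b k l := by
  simpa only [Fintype.sum_prod_type] using
    Finset.sum_comm (s := Finset.univ) (t := Finset.univ) (f := fun p q : ι × ι ↦ F p.1 p.2 q.1 q.2)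

/-- The Ricci curvature of a unimodular metric Lie algebra is orthogonal to all inner
derivations. -/
lemma sum_frameRicci_mul_eq_zero {c : ι → ι → ι → ℝ} (hanti : ∀ i j k, c i j k = -c j i k)
    (htr : ∀ i, ∑ k, c i k k = 0)
    (hjac : ∀ i j k m, ∑ l, (c i j l * c l k m + c j k l * c l i m + c k i l * c l j m) = 0)
    (f : ι) : ∑ a, ∑ b, frameRicci c a b * c f a b = 0 := by
  -- `A a` is the transpose of the usual matrix of `ad e_a`, so the Jacobi identity `hA` expresses
  -- `[e_f, e_a]` by the commutator in reversed order.
  let A : ι → Matrix ι ι ℝ := fun a ↦ Matrix.of (c a)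
  have hA : ∀ a, ∑ b, c f a b • A b = A a * A f - A f * A a := fun a ↦ by
    ext k m
    have := hjac f a k m
    simp only [Matrix.sum_apply, Matrix.smul_apply, Matrix.sub_apply, Matrix.mul_apply, A,
      Matrix.of_apply, smul_eq_mul, ← Finset.sum_sub_distrib]
    rw [← sub_eq_zero, ← Finset.sum_sub_distrib, ← this]
    refine Finset.sum_congr rfl fun l _ ↦ ?_
    rw [hanti l f m, hanti k f l, hanti l a m]
    ring
  set S : ℝ := ∑ a, ((A a).transpose * A a * A f).trace with hS
  set Q : ℝ := ∑ a, ((A a).transpose * A f * A a).trace with hQ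
  have h1 : ∑ a, ∑ b, (∑ k, ∑ l, c a k l * c b k l) * c f a b = S - Q := by
    rw [hS, hQ, ← Finset.sum_sub_distrib]
    refine Finset.sum_congr rfl fun a _ ↦ ?_
    rw [← Matrix.trace_sub, mul_assoc, mul_assoc, ← mul_sub, ← hA, Finset.mul_sum,
      Matrix.trace_sum]
    refine Finset.sum_congr rfl fun b _ ↦ ?_
    simp only [Matrix.trace, Matrix.diag, Matrix.mul_apply, A, Matrix.transpose_apply,
      Matrix.smul_apply, smul_eq_mul, Matrix.of_apply, Finset.sum_mul]
    rw [Finset.sum_comm]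
    exact Finset.sum_congr rfl fun l _ ↦ Finset.sum_congr rfl fun k _ ↦ by ring
  -- The sum already computed in `h1`, now read off by exchanging summation indices and
  -- antisymmetry. Half of its coefficient `-1/2` is evaluated each way, so `Q` cancels and `-S/4`
  -- meets `+S/4` from the last term; the Killing-form term vanishes by cyclicity of the trace.
  have h1' : ∑ a, ∑ b, (∑ k, ∑ l, c a k l * c b k l) * c f a b = Q := by
    rw [hQ]
    simp only [Matrix.trace, Matrix.diag, Matrix.mul_apply, A, Matrix.transpose_apply,
      Matrix.of_apply, Finset.sum_mul]
    rw [sum_four_comm]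
    refine Finset.sum_congr rfl fun a _ ↦ Finset.sum_congr rfl fun i _ ↦ ?_
    rw [Finset.sum_comm]
    refine Finset.sum_congr rfl fun j _ ↦ Finset.sum_congr rfl fun k _ ↦ ?_
    rw [hanti k, hanti j]; ring
  have h2 : ∑ a, ∑ b, (∑ k, ∑ l, c a k l * c b l k) * c f a b = 0 := by
    have : ∀ a, ∑ b, (∑ k, ∑ l, c a k l * c b l k) * c f a b = 0 := fun a ↦ by
      have h : (A a * ∑ b, c f a b • A b).trace = 0 := by
        rw [hA, mul_sub, Matrix.trace_sub, ← mul_assoc, ← mul_assoc,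
          Matrix.trace_mul_cycle (A a) (A f), sub_self]
      rw [← h, Finset.mul_sum, Matrix.trace_sum]
      refine Finset.sum_congr rfl fun b _ ↦ ?_
      simp only [Matrix.trace, Matrix.diag, Matrix.mul_apply, A, Matrix.smul_apply, smul_eq_mul,
        Matrix.of_apply, Finset.sum_mul]
      exact Finset.sum_congr rfl fun l _ ↦ Finset.sum_congr rfl fun k _ ↦ by ring
    simp [this]
  have h3 : ∑ a, ∑ b, (∑ k, ∑ l, c k l a * c k l b) * c f a b = S := by
    rw [hS]
    simp only [Matrix.trace, Matrix.diag, Matrix.mul_apply, A, Matrix.transpose_apply,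
      Matrix.of_apply, Finset.sum_mul]
    rw [sum_four_comm]
    refine Finset.sum_congr rfl fun a _ ↦ ?_
    rw [Finset.sum_comm, Finset.sum_comm (f := fun i j ↦ ∑ k, c a k i * c a k j * c f j i)]
    refine Finset.sum_congr rfl fun j _ ↦ ?_
    rw [Finset.sum_comm]
    refine Finset.sum_congr rfl fun i _ ↦ Finset.sum_congr rfl fun k _ ↦ ?_
    ring
  simp only [frameRicci_eq hanti htr, Finset.sum_add_distrib, Finset.sum_sub_distrib,
    ← Finset.mul_sum, add_mul, sub_mul, mul_assoc]
  linear_combination (-1 / 4 : ℝ) * h1 - (1 / 4 : ℝ) * h1' - (1 / 2 : ℝ) * h2 + (1 / 4 : ℝ) * h3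

end StructureConstants

/-! ### The integrated equation -/

section Integration

open MeasureTheory

/-- The integrated quasi-Einstein equation in a unimodular orthonormal frame. Here `f` are the
components of the vector field, `a i j` is the derivative of `f j` in the direction of the `i`-th
frame field, and the vanishing quantity is half the Lie derivative of the metric. -/
lemma lieDeriv_frame_eq_zero {ι : Type*} [Fintype ι] [DecidableEq ι] {Ω : Type*}
    [TopologicalSpace Ω] [CompactSpace Ω] [MeasurableSpace Ω] [BorelSpace Ω] (μ : Measure Ω)
    [IsFiniteMeasure μ] [μ.IsOpenPosMeasure] {c : ι → ι → ι → ℝ} {r : ι → ι → ℝ} {m l : ℝ}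
    (hm : m ≠ 0) {f : ι → Ω → ℝ} {a : ι → ι → Ω → ℝ} {K : ι → ι → Ω → ℝ}
    (hanti : ∀ i j k, c i j k = -c j i k) (htr : ∀ i, ∑ k, c i k k = 0)
    (hr : ∀ k, ∑ i, ∑ j, r i j * c k i j = 0)
    (hf : ∀ i, Continuous (f i)) (ha : ∀ i j, Continuous (a i j))
    (hK : ∀ i j x, K i j x = (a i j x + a j i x - ∑ k, f k x * (c k i j + c k j i)) / 2)
    (heq : ∀ i j x, r i j + K i j x - 1 / m * (f i x * f j x) = l * if i = j then 1 else 0)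
    (hmean : ∀ i j, ∫ x, a i j x ∂μ = 0)
    (hmean' : ∀ i, ∫ x, (a i i x * ∑ j, f j x * f j x + 2 * f i x * ∑ j, f j x * a i j x) ∂μ = 0)
    (i j : ι) (x : Ω) : K i j x = 0 := by
  have hKs : ∀ i j x, K i j x = K j i x := fun i j x ↦ by
    rw [hK, hK, add_comm (a i j x)]; simp only [add_comm]
  have hrs : ∀ i j, r i j = r j i := fun i j ↦ by
    have h1 := heq i j x
    have h2 := heq j i x
    rw [hKs j i] at h2
    simp only [eq_comm (a := j)] at h2
    linarith
  -- `D` is the divergence of the field, by unimodularity, and `N` is its squared length.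
  set D : Ω → ℝ := fun x ↦ ∑ i, a i i x
  set N : Ω → ℝ := fun x ↦ ∑ i, f i x * f i x
  have hKtr : ∀ x, ∑ i, K i i x = D x := fun x ↦ by
    have : ∑ i, ∑ k, f k x * (c k i i + c k i i) = 0 := by
      rw [Finset.sum_comm]
      simp [← Finset.mul_sum, Finset.sum_add_distrib, htr]
    calc ∑ i, K i i x = ∑ i, a i i x - (∑ i, ∑ k, f k x * (c k i i + c k i i)) / 2 := by
          rw [Finset.sum_div, ← Finset.sum_sub_distrib]
          exact Finset.sum_congr rfl fun i _ ↦ by rw [hK]; ring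
      _ = D x := by rw [this]; simp [D]
  set κ : ℝ := ∑ i, r i i - l * Fintype.card ι with hκ
  have hN : ∀ x, N x = m * (D x + κ) := fun x ↦ by
    have : ∑ i, (r i i + K i i x - 1 / m * (f i x * f i x)) = ∑ _i : ι, l * 1 :=
      Finset.sum_congr rfl fun i _ ↦ by simpa using heq i i x
    rw [Finset.sum_sub_distrib, Finset.sum_add_distrib, hKtr, ← Finset.mul_sum] at this
    simp only [mul_one, Finset.sum_const, Finset.card_univ, nsmul_eq_mul] at this
    change _ + _ - 1 / m * N x = _ at this
    have h2 : N x = m * (1 / m * N x) := by field_simp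
    rw [h2]
    congr 1
    linarith
  have hrK : ∀ x, ∑ i, ∑ j, r i j * K i j x = ∑ i, ∑ j, r i j * a i j x := fun x ↦ by
    have h1 : ∑ i, ∑ j, r i j * a j i x = ∑ i, ∑ j, r i j * a i j x := by
      rw [Finset.sum_comm]
      exact Finset.sum_congr rfl fun i _ ↦ Finset.sum_congr rfl fun j _ ↦ by rw [hrs]
    have h2 : ∀ k, ∑ i, ∑ j, r i j * c k j i = 0 := fun k ↦ by
      rw [Finset.sum_comm, ← hr k]
      exact Finset.sum_congr rfl fun i _ ↦ Finset.sum_congr rfl fun j _ ↦ by rw [hrs]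
    have h3 : ∑ i, ∑ j, r i j * ∑ k, f k x * (c k i j + c k j i) = 0 := by
      calc _ = ∑ k, f k x * (∑ i, ∑ j, r i j * c k i j + ∑ i, ∑ j, r i j * c k j i) := by
            simp only [Finset.mul_sum, mul_add, ← Finset.sum_add_distrib]
            rw [Finset.sum_comm_cycle]
            refine Finset.sum_congr rfl fun i _ ↦ Finset.sum_congr rfl fun j _ ↦
              Finset.sum_congr rfl fun k _ ↦ by ring
        _ = 0 := by simp [h2, hr]
    calc _ = (∑ i, ∑ j, r i j * a i j x + ∑ i, ∑ j, r i j * a j i x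
          - ∑ i, ∑ j, r i j * ∑ k, f k x * (c k i j + c k j i)) / 2 := by
          simp only [← Finset.sum_add_distrib, ← Finset.sum_sub_distrib, Finset.sum_div, hK]
          exact Finset.sum_congr rfl fun i _ ↦ Finset.sum_congr rfl fun j _ ↦ by ring
      _ = _ := by rw [h1, h3]; ring
  have hfK : ∀ x, ∑ i, ∑ j, f i x * f j x * K i j x = ∑ i, ∑ j, f i x * f j x * a i j x :=
      fun x ↦ by
    have h1 : ∑ i, ∑ j, f i x * f j x * a j i x = ∑ i, ∑ j, f i x * f j x * a i j x := by
      rw [Finset.sum_comm]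
      exact Finset.sum_congr rfl fun i _ ↦ Finset.sum_congr rfl fun j _ ↦ by ring
    -- The product of the `f`'s is symmetric in `k` and `i` while `c` is antisymmetric, so the sum
    -- equals its own negative.
    have h2 : ∑ i, ∑ j, ∑ k, f i x * f j x * (f k x * c k i j) = 0 := by
      rw [Finset.sum_comm_cycle]
      have h : ∀ k, ∑ i, ∑ j, f i x * f j x * (f k x * c k i j)
          = ∑ i, ∑ j, -(f j x * f i x * (f k x * c i k j)) := fun k ↦
        Finset.sum_congr rfl fun i _ ↦ Finset.sum_congr rfl fun j _ ↦ by rw [hanti]; ring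
      have h' : ∑ k, ∑ i, ∑ j, f i x * f j x * (f k x * c k i j)
          = -∑ k, ∑ i, ∑ j, f i x * f j x * (f k x * c k i j) := by
        conv_lhs => rw [Finset.sum_congr rfl fun k _ ↦ h k, Finset.sum_comm]
        simp only [← Finset.sum_neg_distrib]
        refine Finset.sum_congr rfl fun i _ ↦ Finset.sum_congr rfl fun k _ ↦
          Finset.sum_congr rfl fun j _ ↦ by ring
      linarith
    have h3 : ∑ i, ∑ j, ∑ k, f i x * f j x * (f k x * c k j i) = 0 := by
      rw [Finset.sum_comm, ← h2]
      exact Finset.sum_congr rfl fun i _ ↦ Finset.sum_congr rfl fun j _ ↦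
        Finset.sum_congr rfl fun k _ ↦ by ring
    calc _ = (∑ i, ∑ j, f i x * f j x * a i j x + ∑ i, ∑ j, f i x * f j x * a j i x
          - (∑ i, ∑ j, ∑ k, f i x * f j x * (f k x * c k i j)
            + ∑ i, ∑ j, ∑ k, f i x * f j x * (f k x * c k j i))) / 2 := by
          simp only [← Finset.sum_add_distrib, ← Finset.sum_sub_distrib, Finset.sum_div, hK,
            ← mul_add, ← Finset.mul_sum]
          exact Finset.sum_congr rfl fun i _ ↦ Finset.sum_congr rfl fun j _ ↦ by ring
      _ = _ := by rw [h1, h2, h3]; ring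
  -- Contract the equation with `K`, then use `N = m (D + κ)` in `div(N X) = D N + 2 K(X, X)`; the
  -- term `m D²` produced there moves to the left as `D²/2`.
  have key : ∀ x, ∑ i, ∑ j, K i j x ^ 2 + D x ^ 2 / 2 =
      -(∑ i, ∑ j, r i j * a i j x) + (l - κ / 2) * ∑ i, a i i x + 1 / (2 * m) *
      ∑ i, (a i i x * ∑ j, f j x * f j x + 2 * f i x * ∑ j, f j x * a i j x) := fun x ↦ by
    have h1 : ∑ i, ∑ j, K i j x ^ 2 = l * D x + 1 / m * (∑ i, ∑ j, f i x * f j x * K i j x)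
        - ∑ i, ∑ j, r i j * K i j x := by
      calc _ = ∑ i, ∑ j, (l * (if i = j then 1 else 0)) * K i j x
            + 1 / m * (∑ i, ∑ j, f i x * f j x * K i j x) - ∑ i, ∑ j, r i j * K i j x := by
            simp only [Finset.mul_sum, ← Finset.sum_add_distrib, ← Finset.sum_sub_distrib]
            refine Finset.sum_congr rfl fun i _ ↦ Finset.sum_congr rfl fun j _ ↦ ?_
            rw [← heq i j x]; ring
        _ = _ := by simp [← hKtr, Finset.mul_sum]
    have h2 : ∑ i, (a i i x * ∑ j, f j x * f j x + 2 * f i x * ∑ j, f j x * a i j x)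
        = D x * N x + 2 * ∑ i, ∑ j, f i x * f j x * a i j x := by
      rw [Finset.sum_add_distrib, ← Finset.sum_mul]
      congr 1
      simp only [Finset.mul_sum]
      exact Finset.sum_congr rfl fun i _ ↦ Finset.sum_congr rfl fun j _ ↦ by ring
    rw [h1, h2, hrK, hfK, hN]
    change _ = _ + (l - κ / 2) * D x + _
    field_simp
    ring
  have hKc : ∀ i j, Continuous (K i j) := fun i j ↦ by
    have : K i j = fun x ↦ _ := funext fun x ↦ hK i j x
    rw [this]; fun_prop
  have hint : ∀ {h : Ω → ℝ}, Continuous h → Integrable h μ := fun hh ↦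
    hh.integrable_of_hasCompactSupport (HasCompactSupport.of_compactSpace _)
  have hzero : ∫ x, (∑ i, ∑ j, K i j x ^ 2 + D x ^ 2 / 2) ∂μ = 0 := by
    simp only [key]
    rw [integral_add (hint (by fun_prop)) (hint (by fun_prop)),
      integral_add (hint (by fun_prop)) (hint (by fun_prop)), integral_neg, integral_const_mul,
      integral_const_mul, integral_finsetSum _ fun _ _ ↦ hint (by fun_prop),
      integral_finsetSum _ fun _ _ ↦ hint (by fun_prop),
      integral_finsetSum _ fun _ _ ↦ hint (by fun_prop)]
    have : ∀ i, ∫ x, ∑ j, r i j * a i j x ∂μ = 0 := fun i ↦ by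
      rw [integral_finsetSum _ fun _ _ ↦ hint (by fun_prop)]
      simp [integral_const_mul, hmean]
    simp [this, hmean, hmean']
  have hcont : Continuous fun x ↦ ∑ i, ∑ j, K i j x ^ 2 + D x ^ 2 / 2 := by fun_prop
  have hnn : 0 ≤ fun x ↦ ∑ i, ∑ j, K i j x ^ 2 + D x ^ 2 / 2 := fun x ↦ by
    dsimp; positivity
  -- Almost everywhere becomes everywhere by continuity, since nonempty open sets have positive
  -- measure.
  have h0 := (hcont.ae_eq_iff_eq μ continuous_const).1
    ((integral_eq_zero_iff_of_nonneg hnn (hint hcont)).1 hzero)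
  have h1 : ∑ i, ∑ j, K i j x ^ 2 + D x ^ 2 / 2 = 0 := congrFun h0 x
  have h2 : ∑ i, ∑ j, K i j x ^ 2 = 0 := by
    have : 0 ≤ ∑ i, ∑ j, K i j x ^ 2 := by positivity
    have h3 : 0 ≤ D x ^ 2 / 2 := by positivity
    linarith
  rw [Finset.sum_eq_zero_iff_of_nonneg fun _ _ ↦ by positivity] at h2
  have h3 := h2 i (Finset.mem_univ _)
  rw [Finset.sum_eq_zero_iff_of_nonneg fun _ _ ↦ by positivity] at h3
  exact pow_eq_zero_iff two_ne_zero |>.1 (h3 j (Finset.mem_univ _))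

end Integration

/-! ### Derivatives along fields and curves -/

section Calculus

open VectorField Filter Topology

variable {E : Type*} [NormedAddCommGroup E] [NormedSpace ℝ E]
  {H : Type*} [TopologicalSpace H] {I : ModelWithCorners ℝ E H}
  {M : Type*} [TopologicalSpace M] [ChartedSpace H M]

/-- The derivative of a smooth function along a smooth vector field is smooth. -/
lemma contMDiff_mvfderiv_apply [IsManifold I ∞ M] {h : M → ℝ} (hh : ContMDiff I 𝓘(ℝ, ℝ) ∞ h)
    {V : Π x : M, TangentSpace I x} (hV : IsSmoothField I V) :
    ContMDiff I 𝓘(ℝ, ℝ) ∞ (fun x ↦ mvfderiv I h x (V x)) :=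
  (contMDiff_snd_tangentBundle_modelSpace ℝ 𝓘(ℝ, ℝ)).comp
    ((hh.contMDiff_tangentMap (m := ∞) (by simp)).comp hV)

/-- The chain rule along a curve. -/
lemma hasDerivAt_comp_curve {k : M → ℝ} {γ : ℝ → M} {t : ℝ} {v : TangentSpace I (γ t)}
    (hk : MDifferentiableAt I 𝓘(ℝ, ℝ) k (γ t))
    (hγ : HasMFDerivAt 𝓘(ℝ, ℝ) I γ t (ContinuousLinearMap.toSpanSingleton ℝ v)) :
    HasDerivAt (fun s ↦ k (γ s)) (mvfderiv I k (γ t) v) t := by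
  have h := (hk.hasMFDerivAt.comp t hγ).hasFDerivAt
  have h2 : HasFDerivAt (fun s ↦ k (γ s))
      (ContinuousLinearMap.toSpanSingleton ℝ (mvfderiv I k (γ t) v)) t := by
    refine h.congr_fderiv ?_
    ext
    change mfderiv I 𝓘(ℝ, ℝ) k (γ t) ((1 : ℝ) • v) = (1 : ℝ) • mvfderiv I k (γ t) v
    rw [one_smul, one_smul]
    rfl
  simpa using h2.hasDerivAt

/-- A smooth function has a continuous partial derivative in a real parameter. -/
lemma continuous_deriv_param [IsManifold I ∞ M] {Φ : ℝ × M → ℝ}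
    (hΦ : ContMDiff (𝓘(ℝ, ℝ).prod I) 𝓘(ℝ, ℝ) ∞ Φ) :
    Continuous (fun p : ℝ × M ↦ deriv (fun t ↦ Φ (t, p.2)) p.1) := by
  -- The partial derivative in `t` is the derivative along the smooth field `∂/∂t` on `ℝ × M`, hence
  -- smooth.
  let V : Π p : ℝ × M, TangentSpace (𝓘(ℝ, ℝ).prod I) p := fun _ ↦ ((1 : ℝ), (0 : E))
  have hV : IsSmoothField (𝓘(ℝ, ℝ).prod I) V := by
    have h1 : ContMDiff 𝓘(ℝ, ℝ) 𝓘(ℝ, ℝ).tangent ∞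
        (fun t : ℝ ↦ (⟨t, (1 : ℝ)⟩ : TangentBundle 𝓘(ℝ, ℝ) ℝ)) :=
      contMDiff_vectorSpace_iff_contDiff.2 contDiff_const
    have h2 : ContMDiff I I.tangent ∞ (fun x : M ↦ (⟨x, (0 : E)⟩ : TangentBundle I M)) :=
      Bundle.contMDiff_zeroSection ℝ _
    exact contMDiff_equivTangentBundleProd_symm.comp
      ((h1.comp contMDiff_fst).prodMk (h2.comp contMDiff_snd))
  refine (contMDiff_mvfderiv_apply hΦ hV).continuous.congr fun p ↦ ?_
  have h1 := (hasMFDerivAt_id (I := 𝓘(ℝ, ℝ)) p.1).prodMk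
    (hasMFDerivAt_const (I := 𝓘(ℝ, ℝ)) (I' := I) p.2 p.1)
  refine (hasDerivAt_comp_curve (γ := fun t ↦ (t, p.2)) (t := p.1) (v := V p)
    (hΦ.mdifferentiableAt (by simp)) ?_).deriv.symm
  have h2 : ContinuousLinearMap.toSpanSingleton ℝ (V p) =
      (ContinuousLinearMap.id ℝ (TangentSpace 𝓘(ℝ, ℝ) p.1)).prod
        (0 : TangentSpace 𝓘(ℝ, ℝ) p.1 →L[ℝ] TangentSpace I p.2) := by
    apply ContinuousLinearMap.ext
    intro a
    change (a • (1 : ℝ), a • (0 : E)) = ((a : ℝ), (0 : E))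
    simp
  rw [h2]
  exact h1

end Calculus

/-! ### Lie brackets as commutators, and curves with prescribed velocity -/

section Boundaryless

open VectorField Filter Topology

variable {E : Type*} [NormedAddCommGroup E] [NormedSpace ℝ E]
  {M : Type*} [TopologicalSpace M] [ChartedSpace E M]

lemma mvfderiv_eq_fderiv {k : M → ℝ} {x : M} (hk : MDifferentiableAt 𝓘(ℝ, E) 𝓘(ℝ, ℝ) k x) :
    mvfderiv 𝓘(ℝ, E) k x =
      fderiv ℝ (k ∘ (extChartAt 𝓘(ℝ, E) x).symm) (extChartAt 𝓘(ℝ, E) x x) := by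
  rw [hk.mvfderiv, ModelWithCorners.range_eq_univ, fderivWithin_univ]
  rfl

/-- Differentiation along a Lie bracket is the commutator of differentiations. -/
lemma mvfderiv_mlieBracket [IsManifold 𝓘(ℝ, E) ∞ M] [CompleteSpace E]
    {h : M → ℝ} {x : M} (hh : ContMDiffAt 𝓘(ℝ, E) 𝓘(ℝ, ℝ) ∞ h x)
    {V W : Π x : M, TangentSpace 𝓘(ℝ, E) x} (hV : MDiffAt (T% V) x) (hW : MDiffAt (T% W) x) :
    mvfderiv 𝓘(ℝ, E) h x (mlieBracket 𝓘(ℝ, E) V W x) =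
      mvfderiv 𝓘(ℝ, E) (fun y ↦ mvfderiv 𝓘(ℝ, E) h y (W y)) x (V x)
        - mvfderiv 𝓘(ℝ, E) (fun y ↦ mvfderiv 𝓘(ℝ, E) h y (V y)) x (W x) := by
  set φ := extChartAt 𝓘(ℝ, E) x with hφ
  have hE : IsManifold 𝓘(ℝ, E) 2 M := .of_le (n := ∞) (by exact ENat.LEInfty.out)
  let P : (Π x : M, TangentSpace 𝓘(ℝ, E) x) → E → E := fun U ↦
    -- Both fields are read in the chart at `x`, where the claim is the vector-space identity
    -- `fderiv_apply_lieBracket`. At the base point the chart differential is the identity of `E`,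
    -- so values and brackets there need no conversion.
    mpullbackWithin 𝓘(ℝ, E) 𝓘(ℝ, E) φ.symm U (Set.range 𝓘(ℝ, E))
  have hP : ∀ {U : Π x : M, TangentSpace 𝓘(ℝ, E) x}, MDiffAt (T% U) x →
      DifferentiableAt ℝ (P U) (φ x) := fun {U} hU ↦ by
    have := MDifferentiableWithinAt.differentiableWithinAt_mpullbackWithin_vectorField
      (mdifferentiableWithinAt_univ.2 hU)
    rw [Set.preimage_univ, ModelWithCorners.range_eq_univ, Set.univ_inter] at this
    change DifferentiableAt ℝ (mpullbackWithin 𝓘(ℝ, E) 𝓘(ℝ, E) φ.symm U (Set.range 𝓘(ℝ, E))) (φ x)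
    rw [ModelWithCorners.range_eq_univ]
    exact differentiableWithinAt_univ.1 this
  have hinv : ∀ A : E →L[ℝ] E, A = ContinuousLinearMap.id ℝ E → ∀ w, A.inverse w = w := by
    rintro _ rfl w; simp
  have hPx : ∀ U, P U (φ x) = U x := fun U ↦ by
    change (mfderivWithin 𝓘(ℝ, E) 𝓘(ℝ, E) φ.symm (Set.range 𝓘(ℝ, E)) (φ x)).inverse
      (U (φ.symm (φ x))) = _
    exact (hinv _ (mfderivWithin_range_extChartAt_symm (I := 𝓘(ℝ, E)) (x := x)) _).trans
      (congrArg (fun y ↦ (show E from U y)) (extChartAt_to_inv x))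
  have hbr : mlieBracket 𝓘(ℝ, E) V W x = lieBracket ℝ (P V) (P W) (φ x) := by
    rw [← mlieBracketWithin_univ, mlieBracketWithin_apply, Set.preimage_univ, Set.univ_inter,
      ← lieBracketWithin_univ]
    refine (hinv _ (mfderiv_extChartAt_self (I := 𝓘(ℝ, E)) (x := x)) _).trans ?_
    rw [ModelWithCorners.range_eq_univ]
    simp only [P, ModelWithCorners.range_eq_univ]
    rfl
  have hh' : ContDiffAt ℝ ∞ (h ∘ φ.symm) (φ x) := by
    have := (contMDiffAt_iff.1 hh).2
    rwa [ModelWithCorners.range_eq_univ, contDiffWithinAt_univ] at this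
  -- Needed on a neighbourhood, not just at `x`, because the function is differentiated once more.
  have hev : ∀ᶠ y in 𝓝 x, ∀ U : Π x : M, TangentSpace 𝓘(ℝ, E) x,
      mvfderiv 𝓘(ℝ, E) h y (U y) = fderiv ℝ (h ∘ φ.symm) (φ y) (P U (φ y)) := by
    have h1 : ∀ᶠ y in 𝓝 x, ContMDiffAt 𝓘(ℝ, E) 𝓘(ℝ, ℝ) 1 h y :=
      (contMDiffAt_iff_contMDiffAt_nhds (by simp)).1 (hh.of_le (by exact ENat.LEInfty.out))
    filter_upwards [h1, extChartAt_source_mem_nhds (I := 𝓘(ℝ, E)) x] with y hy hys U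
    have hyl : φ.symm (φ y) = y := φ.left_inv hys
    have hs : MDifferentiableAt 𝓘(ℝ, E) 𝓘(ℝ, E) φ.symm (φ y) :=
      (mdifferentiableOn_extChartAt_symm (I := 𝓘(ℝ, E)) _ (φ.map_source hys)).mdifferentiableAt
        ((isOpen_extChartAt_target x).mem_nhds (φ.map_source hys))
    have hinv := isInvertible_mfderivWithin_extChartAt_symm (I := 𝓘(ℝ, E)) (φ.map_source hys)
    have hPy : P U (φ y) = (mfderivWithin 𝓘(ℝ, E) 𝓘(ℝ, E) φ.symm (Set.range 𝓘(ℝ, E)) (φ y)).inverse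
      (U (φ.symm (φ y))) := rfl
    rw [hPy, ← mfderiv_eq_fderiv, mfderiv_comp (I' := 𝓘(ℝ, E)) _ (by
      rw [hyl]; exact hy.mdifferentiableAt (by simp)) hs]
    rw [ModelWithCorners.range_eq_univ, mfderivWithin_univ] at hinv ⊢
    change _ = mfderiv 𝓘(ℝ, E) 𝓘(ℝ, ℝ) h (φ.symm (φ y)) (mfderiv 𝓘(ℝ, E) 𝓘(ℝ, E) φ.symm (φ y)
      ((mfderiv 𝓘(ℝ, E) 𝓘(ℝ, E) φ.symm (φ y)).inverse (U (φ.symm (φ y)))))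
    rw [hinv.self_apply_inverse, hyl]
    rfl
  have hk : ∀ {U : Π x : M, TangentSpace 𝓘(ℝ, E) x}, MDiffAt (T% U) x →
      mvfderiv 𝓘(ℝ, E) (fun y ↦ mvfderiv 𝓘(ℝ, E) h y (U y)) x =
      fderiv ℝ (fun z ↦ fderiv ℝ (h ∘ φ.symm) z (P U z)) (φ x) := fun {U} hU ↦ by
    have hd : DifferentiableAt ℝ (fun z ↦ fderiv ℝ (h ∘ φ.symm) z (P U z)) (φ x) :=
      ((hh'.fderiv_right (m := 1) (by rw [one_add_one_eq_two]; exact ENat.LEInfty.out)).differentiableAt (by simp)).clm_apply (hP hU)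
    have hfg : (fun y ↦ mvfderiv 𝓘(ℝ, E) h y (U y)) =ᶠ[𝓝 x]
        (fun z ↦ fderiv ℝ (h ∘ φ.symm) z (P U z)) ∘ φ := by
      filter_upwards [hev] with y hy using hy U
    have hm : MDifferentiableAt 𝓘(ℝ, E) 𝓘(ℝ, ℝ) ((fun z ↦ fderiv ℝ (h ∘ φ.symm) z (P U z)) ∘ φ) x :=
      hd.mdifferentiableAt.comp x (mdifferentiableAt_extChartAt (mem_chart_source E x))
    rw [mvfderiv_eq_fderiv (hm.congr_of_eventuallyEq hfg), ← hφ]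
    apply Filter.EventuallyEq.fderiv_eq
    have ht : Tendsto φ.symm (𝓝 (φ x)) (𝓝 x) := by
      simpa [φ, ContinuousAt] using continuousAt_extChartAt_symm (I := 𝓘(ℝ, E)) x
    filter_upwards [ht.eventually hfg, extChartAt_target_mem_nhds (I := 𝓘(ℝ, E)) x] with z hz hzt
    rw [Function.comp_apply, hz, Function.comp_apply, φ.right_inv hzt]
  rw [mvfderiv_eq_fderiv (hh.mdifferentiableAt (by simp)), hk hV, hk hW, hbr, ← hφ]
  have := fderiv_apply_lieBracket hh' (by simpa using ENat.LEInfty.out) (hP hW) (hP hV)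
  rw [hPx, hPx] at this
  exact this

/-- Every tangent vector is the velocity of a smooth curve. -/
lemma exists_curve [IsManifold 𝓘(ℝ, E) ∞ M] (x : M) (v : TangentSpace 𝓘(ℝ, E) x) :
    ∃ γ : ℝ → M, ContMDiff 𝓘(ℝ, ℝ) 𝓘(ℝ, E) ∞ γ ∧ γ 0 = x ∧ HasMFDerivAt 𝓘(ℝ, ℝ) 𝓘(ℝ, E) γ 0
      (ContinuousLinearMap.toSpanSingleton ℝ (show E from v)) := by
  set φ := extChartAt 𝓘(ℝ, E) x with hφ
  obtain ⟨δ, hδ, hball⟩ := Metric.mem_nhds_iff.1 (extChartAt_target_mem_nhds (I := 𝓘(ℝ, E)) x)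
  let w : E := v
  obtain ⟨ε, hε, hεw⟩ : ∃ ε : ℝ, 0 < ε ∧ ε * ‖w‖ < δ := by
    refine ⟨δ / (‖w‖ + 1), by positivity, ?_⟩
    rw [div_mul_eq_mul_div, div_lt_iff₀ (by positivity)]
    nlinarith [norm_nonneg w]
  -- `ε sin(t/ε)` has derivative 1 at 0 but stays within `[-ε, ε]`, so the curve never leaves the
  -- chart and is smooth on all of `ℝ`.
  let ρ : ℝ → E := fun t ↦ φ x + (ε * Real.sin (t / ε)) • w
  have hρ : ∀ t, ρ t ∈ φ.target := fun t ↦ by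
    refine hball ?_
    rw [Metric.mem_ball, dist_eq_norm, add_sub_cancel_left, norm_smul, norm_mul, Real.norm_eq_abs,
      Real.norm_eq_abs, abs_of_pos hε]
    refine lt_of_le_of_lt ?_ hεw
    have := Real.abs_sin_le_one (t / ε)
    gcongr
    nlinarith
  have hρs : ContDiff ℝ ∞ ρ := by
    have : ContDiff ℝ ∞ fun t : ℝ ↦ Real.sin (t / ε) := Real.contDiff_sin.comp (by fun_prop)
    fun_prop
  have hρ0 : ρ 0 = φ x := by simp [ρ]
  refine ⟨fun t ↦ φ.symm (ρ t), ?_, ?_, ?_⟩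
  · exact (contMDiffOn_extChartAt_symm (n := ∞) x).comp_contMDiff hρs.contMDiff hρ
  · simp [hρ0, φ]
  · have h1 : HasDerivAt ρ w 0 := by
      have : HasDerivAt (fun t : ℝ ↦ ε * Real.sin (t / ε)) 1 0 := by
        refine (((hasDerivAt_id (0 : ℝ)).div_const ε).sin.const_mul ε).congr_deriv ?_
        simp [hε.ne']
      have h := (this.smul_const w).const_add (φ x)
      rwa [one_smul] at h
    have h2 : HasMFDerivAt 𝓘(ℝ, E) 𝓘(ℝ, E) φ.symm (φ x) (ContinuousLinearMap.id ℝ E) := by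
      have hs : MDifferentiableAt 𝓘(ℝ, E) 𝓘(ℝ, E) φ.symm (φ x) :=
        (mdifferentiableOn_extChartAt_symm (I := 𝓘(ℝ, E)) _
          (mem_extChartAt_target x)).mdifferentiableAt (extChartAt_target_mem_nhds x)
      have h := mfderivWithin_range_extChartAt_symm (I := 𝓘(ℝ, E)) (x := x)
      rw [ModelWithCorners.range_eq_univ, mfderivWithin_univ] at h
      have h3 := hs.hasMFDerivAt
      rw [h] at h3
      exact h3
    rw [← hρ0] at h2
    exact h2.comp 0 h1.hasFDerivAt.hasMFDerivAt

end Boundaryless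

/-! ### Differentiation under the integral -/

section ParametricIntegral

open MeasureTheory

variable {E : Type*} [NormedAddCommGroup E] [NormedSpace ℝ E]
  {H : Type*} [TopologicalSpace H] {I : ModelWithCorners ℝ E H}
  {M : Type*} [TopologicalSpace M] [ChartedSpace H M] [IsManifold I ∞ M]

/-- The `t`-derivative is continuous, hence bounded on the compact set `[-1, 1] × M`; this constant
is the dominating function. -/
lemma hasDerivAt_integral_param [CompactSpace M] [MeasurableSpace M] [BorelSpace M]
    (μ : Measure M) [IsFiniteMeasure μ] {Φ : ℝ × M → ℝ}
    (hΦ : ContMDiff (𝓘(ℝ, ℝ).prod I) 𝓘(ℝ, ℝ) ∞ Φ) :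
    HasDerivAt (fun t ↦ ∫ x, Φ (t, x) ∂μ) (∫ x, deriv (fun t ↦ Φ (t, x)) 0 ∂μ) 0 := by
  have hc := continuous_deriv_param hΦ
  obtain ⟨C, hC⟩ := ((isCompact_closedBall (0 : ℝ) 1).prod
    (isCompact_univ (X := M))).exists_bound_of_continuousOn hc.continuousOn
  have hΦt : ∀ t, Continuous fun x ↦ Φ (t, x) := fun t ↦ hΦ.continuous.comp (by fun_prop)
  refine (hasDerivAt_integral_of_dominated_loc_of_deriv_le (bound := fun _ ↦ C)
    (F := fun t x ↦ Φ (t, x)) (F' := fun t x ↦ deriv (fun t ↦ Φ (t, x)) t)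
    (Metric.closedBall_mem_nhds 0 one_pos)
    (.of_forall fun t ↦ (hΦt t).aestronglyMeasurable)
    ((hΦt 0).integrable_of_hasCompactSupport (HasCompactSupport.of_compactSpace _))
    (hc.comp (g := fun p : ℝ × M ↦ deriv (fun t ↦ Φ (t, p.2)) p.1)
      (f := fun x ↦ ((0 : ℝ), x)) (by fun_prop)).aestronglyMeasurable
    (.of_forall fun x t ht ↦ hC (t, x) ⟨ht, trivial⟩) (integrable_const C)
    (.of_forall fun x t _ ↦ ?_)).2
  have : ContMDiff 𝓘(ℝ, ℝ) 𝓘(ℝ, ℝ) ∞ fun t ↦ Φ (t, x) :=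
    hΦ.comp (contMDiff_id.prodMk contMDiff_const)
  exact (this.contDiff.differentiable (by simp) t).hasDerivAt

end ParametricIntegral

/-! ### Test functions with prescribed differential -/

section SmoothFunctions

variable {E : Type*} [NormedAddCommGroup E] [NormedSpace ℝ E] [FiniteDimensional ℝ E]
  {M : Type*} [TopologicalSpace M] [ChartedSpace E M] [IsManifold 𝓘(ℝ, E) ∞ M] [T2Space M]

/-- Every covector is the differential of a smooth function. -/
lemma exists_contMDiff_mvfderiv_eq (x : M) (l : TangentSpace 𝓘(ℝ, E) x →L[ℝ] ℝ) :
    ∃ h : M → ℝ, ContMDiff 𝓘(ℝ, E) 𝓘(ℝ, ℝ) ∞ h ∧ mvfderiv 𝓘(ℝ, E) h x = l := by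
  -- The covector composed with the chart has the right differential near `x`; the bump function,
  -- equal to 1 there, makes it global.
  let b : SmoothBumpFunction 𝓘(ℝ, E) x := Classical.arbitrary _
  let l' : E →L[ℝ] ℝ := l
  let k : M → ℝ := fun y ↦ l' (extChartAt 𝓘(ℝ, E) x y)
  have hk : ContMDiffOn 𝓘(ℝ, E) 𝓘(ℝ, ℝ) ∞ k (chartAt E x).source :=
    l'.contMDiff.comp_contMDiffOn (contMDiffOn_extChartAt (n := ∞))
  refine ⟨fun y ↦ b y • k y, b.contMDiff_smul hk, ?_⟩
  have he : (fun y ↦ b y • k y) =ᶠ[nhds x] k := by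
    filter_upwards [b.eventuallyEq_one] with y hy
    simp [hy]
  have h1 : mvfderiv 𝓘(ℝ, E) (fun y ↦ b y • k y) x = mvfderiv 𝓘(ℝ, E) k x := by
    ext v
    change mfderiv 𝓘(ℝ, E) 𝓘(ℝ, ℝ) (fun y ↦ b y • k y) x v = mfderiv 𝓘(ℝ, E) 𝓘(ℝ, ℝ) k x v
    rw [he.mfderiv_eq]
    rfl
  have hkx : MDifferentiableAt 𝓘(ℝ, E) 𝓘(ℝ, ℝ) k x :=
    (hk.contMDiffAt (chart_source_mem_nhds E x)).mdifferentiableAt (by simp)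
  rw [h1, mvfderiv_eq_fderiv hkx]
  have h2 : k ∘ (extChartAt 𝓘(ℝ, E) x).symm =ᶠ[nhds (extChartAt 𝓘(ℝ, E) x x)] l' := by
    filter_upwards [extChartAt_target_mem_nhds (I := 𝓘(ℝ, E)) x] with z hz
    change l' _ = _
    rw [(extChartAt 𝓘(ℝ, E) x).right_inv hz]
  rw [h2.fderiv_eq, l'.fderiv]

end SmoothFunctions

/-! ### Left- and right-invariant fields -/

section InvariantFields

open VectorField MeasureTheory

variable {E : Type*} [NormedAddCommGroup E] [NormedSpace ℝ E]
  {G : Type*} [TopologicalSpace G] [ChartedSpace E G]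

lemma tangentBundle_mk_eq {x y : G} {u w : E} (hxy : x = y) (huw : u = w) :
    (⟨x, u⟩ : TangentBundle 𝓘(ℝ, E) G) = ⟨y, w⟩ := by
  subst hxy huw
  rfl

variable [Group G]

/-- The right-invariant vector field with value `w` at the identity. -/
def rightField (w : GroupLieAlgebra 𝓘(ℝ, E) G) (x : G) : TangentSpace 𝓘(ℝ, E) x :=
  show E from mfderiv 𝓘(ℝ, E) 𝓘(ℝ, E) (fun y ↦ y * x) (1 : G) w

variable [LieGroup 𝓘(ℝ, E) ∞ G]

/-- Invariant fields are values of the differential of multiplication on a zero section paired with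
a fixed vector at 1, so their smoothness is that of the tangent map. -/
lemma isSmoothField_tangentMap_mul (A B : G → TangentBundle 𝓘(ℝ, E) G)
    (hA : ContMDiff 𝓘(ℝ, E) 𝓘(ℝ, E).tangent ∞ A) (hB : ContMDiff 𝓘(ℝ, E) 𝓘(ℝ, E).tangent ∞ B) :
    ContMDiff 𝓘(ℝ, E) 𝓘(ℝ, E).tangent ∞ (fun x ↦ tangentMap (𝓘(ℝ, E).prod 𝓘(ℝ, E)) 𝓘(ℝ, E)
      (fun p : G × G ↦ p.1 * p.2) ((equivTangentBundleProd 𝓘(ℝ, E) G 𝓘(ℝ, E) G).symm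
        (A x, B x))) :=
  ((contMDiff_mul 𝓘(ℝ, E) ∞).contMDiff_tangentMap (m := ∞) (by simp)).comp
    (contMDiff_equivTangentBundleProd_symm.comp (hA.prodMk hB))

lemma isSmoothField_leftField (v : GroupLieAlgebra 𝓘(ℝ, E) G) :
    IsSmoothField 𝓘(ℝ, E) (mulInvariantVectorField v : Π x : G, TangentSpace 𝓘(ℝ, E) x) := by
  have := isSmoothField_tangentMap_mul (fun x : G ↦ ⟨x, (0 : E)⟩) (fun _ : G ↦ ⟨1, v⟩)
    (Bundle.contMDiff_zeroSection ℝ _) contMDiff_const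
  refine this.congr fun x ↦ ?_
  have hm := mfderiv_prod_eq_add_apply (I := 𝓘(ℝ, E)) (I' := 𝓘(ℝ, E)) (I'' := 𝓘(ℝ, E))
    (f := fun p : G × G ↦ p.1 * p.2) (p := (x, 1))
    (v := ((0 : E), (show E from v)))
    ((contMDiff_mul 𝓘(ℝ, E) ∞).mdifferentiableAt (by simp))
  refine tangentBundle_mk_eq (mul_one x).symm (Eq.trans ?_ hm.symm)
  change _ = mfderiv 𝓘(ℝ, E) 𝓘(ℝ, E) (fun z : G ↦ z * 1) x 0 + _
  rw [map_zero, zero_add]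
  rfl

lemma isSmoothField_rightField (w : GroupLieAlgebra 𝓘(ℝ, E) G) :
    IsSmoothField 𝓘(ℝ, E) (rightField w : Π x : G, TangentSpace 𝓘(ℝ, E) x) := by
  have := isSmoothField_tangentMap_mul (fun _ : G ↦ ⟨1, w⟩) (fun x : G ↦ ⟨x, (0 : E)⟩)
    contMDiff_const (Bundle.contMDiff_zeroSection ℝ _)
  refine this.congr fun x ↦ ?_
  have hm := mfderiv_prod_eq_add_apply (I := 𝓘(ℝ, E)) (I' := 𝓘(ℝ, E)) (I'' := 𝓘(ℝ, E))
    (f := fun p : G × G ↦ p.1 * p.2) (p := (1, x))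
    (v := ((show E from w), (0 : E)))
    ((contMDiff_mul 𝓘(ℝ, E) ∞).mdifferentiableAt (by simp))
  refine tangentBundle_mk_eq (one_mul x).symm (Eq.trans ?_ hm.symm)
  change _ = _ + mfderiv 𝓘(ℝ, E) 𝓘(ℝ, E) (fun z : G ↦ 1 * z) x 0
  rw [map_zero, add_zero]
  rfl

lemma hasDerivAt_mul_curve {h : G → ℝ} {x : G} (hh : MDifferentiableAt 𝓘(ℝ, E) 𝓘(ℝ, ℝ) h x)
    {γ : ℝ → G} (h0 : γ 0 = 1) {v : GroupLieAlgebra 𝓘(ℝ, E) G}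
    (hγ : HasMFDerivAt 𝓘(ℝ, ℝ) 𝓘(ℝ, E) γ 0
      (ContinuousLinearMap.toSpanSingleton ℝ (show E from v))) :
    HasDerivAt (fun t ↦ h (x * γ t)) (mvfderiv 𝓘(ℝ, E) h x (mulInvariantVectorField v x)) 0 := by
  have ha : HasMFDerivAt 𝓘(ℝ, E) 𝓘(ℝ, E) (fun y ↦ x * y) (γ 0)
      (mfderiv 𝓘(ℝ, E) 𝓘(ℝ, E) (fun y ↦ x * y) (1 : G)) := by
    rw [h0]
    exact (ContMDiff.mdifferentiableAt (n := ∞) (by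
      exact contMDiff_mul_left) (by simp)).hasMFDerivAt
  have hx : x * γ 0 = x := by rw [h0, mul_one]
  have hc : HasMFDerivAt 𝓘(ℝ, ℝ) 𝓘(ℝ, E) (fun t ↦ x * γ t) 0
      (ContinuousLinearMap.toSpanSingleton ℝ (show E from mulInvariantVectorField v x)) := by
    refine (ha.comp 0 hγ).congr_mfderiv (ContinuousLinearMap.ext ?_)
    intro (s : ℝ)
    exact map_smul (mfderiv 𝓘(ℝ, E) 𝓘(ℝ, E) (fun y ↦ x * y) (1 : G)) s v
  have h1 := hasDerivAt_comp_curve (k := h) (by rw [hx]; exact hh) hc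
  have h2 : ∀ y, y = x → mvfderiv 𝓘(ℝ, E) h y (show E from mulInvariantVectorField v x)
      = mvfderiv 𝓘(ℝ, E) h x (mulInvariantVectorField v x) := by rintro _ rfl; rfl
  rwa [h2 _ hx] at h1

lemma hasDerivAt_curve_mul {h : G → ℝ} {x : G} (hh : MDifferentiableAt 𝓘(ℝ, E) 𝓘(ℝ, ℝ) h x)
    {γ : ℝ → G} (h0 : γ 0 = 1) {v : GroupLieAlgebra 𝓘(ℝ, E) G}
    (hγ : HasMFDerivAt 𝓘(ℝ, ℝ) 𝓘(ℝ, E) γ 0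
      (ContinuousLinearMap.toSpanSingleton ℝ (show E from v))) :
    HasDerivAt (fun t ↦ h (γ t * x)) (mvfderiv 𝓘(ℝ, E) h x (rightField v x)) 0 := by
  have ha : HasMFDerivAt 𝓘(ℝ, E) 𝓘(ℝ, E) (fun y ↦ y * x) (γ 0)
      (mfderiv 𝓘(ℝ, E) 𝓘(ℝ, E) (fun y ↦ y * x) (1 : G)) := by
    rw [h0]
    exact (ContMDiff.mdifferentiableAt (n := ∞) (by
      exact contMDiff_mul_right) (by simp)).hasMFDerivAt
  have hx : γ 0 * x = x := by rw [h0, one_mul]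
  have hc : HasMFDerivAt 𝓘(ℝ, ℝ) 𝓘(ℝ, E) (fun t ↦ γ t * x) 0
      (ContinuousLinearMap.toSpanSingleton ℝ (show E from rightField v x)) := by
    refine (ha.comp 0 hγ).congr_mfderiv (ContinuousLinearMap.ext ?_)
    intro (s : ℝ)
    exact map_smul (mfderiv 𝓘(ℝ, E) 𝓘(ℝ, E) (fun y ↦ y * x) (1 : G)) s v
  have h1 := hasDerivAt_comp_curve (k := h) (by rw [hx]; exact hh) hc
  have h2 : ∀ y, y = x → mvfderiv 𝓘(ℝ, E) h y (show E from rightField v x)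
      = mvfderiv 𝓘(ℝ, E) h x (rightField v x) := by rintro _ rfl; rfl
  rwa [h2 _ hx] at h1

/-- The integral of a derivative along a left-invariant field vanishes. -/
lemma integral_leftField [CompactSpace G] [MeasurableSpace G] [BorelSpace G]
    (μ : Measure G) [IsFiniteMeasure μ] [μ.IsMulRightInvariant] {h : G → ℝ}
    (hh : ContMDiff 𝓘(ℝ, E) 𝓘(ℝ, ℝ) ∞ h) (v : GroupLieAlgebra 𝓘(ℝ, E) G) :
    ∫ x, mvfderiv 𝓘(ℝ, E) h x (mulInvariantVectorField v x) ∂μ = 0 := by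
  have : IsTopologicalGroup G := topologicalGroup_of_lieGroup 𝓘(ℝ, E) ∞
  obtain ⟨γ, hγ, h0, hd⟩ := exists_curve (1 : G) v
  -- Left-invariant fields generate right translations: the integral of `h (x * γ t)` does not
  -- depend on `t`, and its derivative at 0 is the integral in question.
  have hΦ : ContMDiff (𝓘(ℝ, ℝ).prod 𝓘(ℝ, E)) 𝓘(ℝ, ℝ) ∞ fun p : ℝ × G ↦ h (p.2 * γ p.1) :=
    hh.comp (contMDiff_snd.mul (hγ.comp contMDiff_fst))
  have h1 := hasDerivAt_integral_param μ hΦ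
  simp only [integral_mul_right_eq_self,
    fun x ↦ (hasDerivAt_mul_curve (hh.mdifferentiableAt (by simp) (x := x)) h0 hd).deriv] at h1
  exact h1.unique (hasDerivAt_const _ _)

/-- The integral of a derivative along a right-invariant field vanishes. -/
lemma integral_rightField [CompactSpace G] [MeasurableSpace G] [BorelSpace G]
    (μ : Measure G) [IsFiniteMeasure μ] [μ.IsMulLeftInvariant] {h : G → ℝ}
    (hh : ContMDiff 𝓘(ℝ, E) 𝓘(ℝ, ℝ) ∞ h) (v : GroupLieAlgebra 𝓘(ℝ, E) G) :
    ∫ x, mvfderiv 𝓘(ℝ, E) h x (rightField v x) ∂μ = 0 := by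
  have : IsTopologicalGroup G := topologicalGroup_of_lieGroup 𝓘(ℝ, E) ∞
  obtain ⟨γ, hγ, h0, hd⟩ := exists_curve (1 : G) v
  have hΦ : ContMDiff (𝓘(ℝ, ℝ).prod 𝓘(ℝ, E)) 𝓘(ℝ, ℝ) ∞ fun p : ℝ × G ↦ h (γ p.1 * p.2) :=
    hh.comp ((hγ.comp contMDiff_fst).mul contMDiff_snd)
  have h1 := hasDerivAt_integral_param μ hΦ
  simp only [integral_mul_left_eq_self,
    fun x ↦ (hasDerivAt_curve_mul (hh.mdifferentiableAt (by simp) (x := x)) h0 hd).deriv] at h1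
  exact h1.unique (hasDerivAt_const _ _)

/-- Left- and right-invariant fields commute as differential operators. -/
lemma leftField_rightField_comm {h : G → ℝ} (hh : ContMDiff 𝓘(ℝ, E) 𝓘(ℝ, ℝ) ∞ h)
    (v w : GroupLieAlgebra 𝓘(ℝ, E) G) (x : G) :
    mvfderiv 𝓘(ℝ, E) (fun y ↦ mvfderiv 𝓘(ℝ, E) h y (rightField w y)) x
        (mulInvariantVectorField v x) =
      mvfderiv 𝓘(ℝ, E) (fun y ↦ mvfderiv 𝓘(ℝ, E) h y (mulInvariantVectorField v y)) x
        (rightField w x) := by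
  obtain ⟨γ, hγ, h0, hd⟩ := exists_curve (1 : G) v
  obtain ⟨η, hη, hη0, hηd⟩ := exists_curve (1 : G) w
  -- Left and right multiplication commute, so both sides are mixed partial derivatives of `F` at 0,
  -- equal by symmetry.
  let F : ℝ × ℝ → ℝ := fun p ↦ h (η p.1 * x * γ p.2)
  have hF : ContDiff ℝ ∞ F := by
    have : ContMDiff 𝓘(ℝ, ℝ × ℝ) 𝓘(ℝ, ℝ) ∞ F :=
      hh.comp (((hη.comp contDiff_fst.contMDiff).mul contMDiff_const).mul
        (hγ.comp contDiff_snd.contMDiff))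
    exact this.contDiff
  have hFd : ∀ p, HasFDerivAt F (fderiv ℝ F p) p := fun p ↦
    (hF.differentiable (by simp) p).hasFDerivAt
  have h1 : ∀ t, mvfderiv 𝓘(ℝ, E) h (x * γ t) (rightField w (x * γ t))
      = fderiv ℝ F (0, t) (1, 0) := fun t ↦ by
    have ha := hasDerivAt_curve_mul (hh.mdifferentiableAt (by simp) (x := x * γ t)) hη0 hηd
    have hb := (hFd (0, t)).comp_hasDerivAt (0 : ℝ)
      ((hasDerivAt_id (0 : ℝ)).prodMk (hasDerivAt_const (0 : ℝ) t))
    refine ha.unique (hb.congr_of_eventuallyEq (.of_forall fun s ↦ ?_))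
    simp [F, mul_assoc]
  have h2 : ∀ s, mvfderiv 𝓘(ℝ, E) h (η s * x) (mulInvariantVectorField v (η s * x))
      = fderiv ℝ F (s, 0) (0, 1) := fun s ↦ by
    have ha := hasDerivAt_mul_curve (hh.mdifferentiableAt (by simp) (x := η s * x)) h0 hd
    have hb := (hFd (s, 0)).comp_hasDerivAt (0 : ℝ)
      ((hasDerivAt_const (0 : ℝ) s).prodMk (hasDerivAt_id (0 : ℝ)))
    exact ha.unique (hb.congr_of_eventuallyEq (.of_forall fun t ↦ by simp [F]))
  have hF2 : ∀ u, DifferentiableAt ℝ (fun p ↦ fderiv ℝ F p u) 0 := fun u ↦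
    ((hF.fderiv_right (m := 1) (by rw [one_add_one_eq_two]; exact ENat.LEInfty.out)).differentiable
      (by simp) 0).clm_apply (differentiableAt_const u)
  have h3 := hasDerivAt_mul_curve ((contMDiff_mvfderiv_apply hh
    (isSmoothField_rightField w)).mdifferentiableAt (by simp) (x := x)) h0 hd
  have h4 := hasDerivAt_curve_mul ((contMDiff_mvfderiv_apply hh
    (isSmoothField_leftField v)).mdifferentiableAt (by simp) (x := x)) hη0 hηd
  simp only [h1] at h3
  simp only [h2] at h4
  have h5 := (hF2 (1, 0)).hasFDerivAt.comp_hasDerivAt (0 : ℝ)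
      (f := fun t : ℝ ↦ ((0 : ℝ), t))
      ((hasDerivAt_const (0 : ℝ) (0 : ℝ)).prodMk (hasDerivAt_id (0 : ℝ)))
  have h6 := (hF2 (0, 1)).hasFDerivAt.comp_hasDerivAt (0 : ℝ)
      (f := fun s : ℝ ↦ (s, (0 : ℝ)))
      ((hasDerivAt_id (0 : ℝ)).prodMk (hasDerivAt_const (0 : ℝ) (0 : ℝ)))
  rw [h3.unique h5, h4.unique h6]
  have h7 := fderiv_apply_lieBracket (V := fun _ ↦ ((0 : ℝ), (1 : ℝ)))
    (W := fun _ ↦ ((1 : ℝ), (0 : ℝ))) (x := 0) hF.contDiffAt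
    (by simpa using ENat.LEInfty.out) (differentiableAt_const _) (differentiableAt_const _)
  simp only [lieBracket, fderiv_fun_const, Pi.zero_apply, zero_apply, sub_zero, map_zero] at h7
  exact (sub_eq_zero.1 h7.symm)

/-- Left- and right-invariant fields commute. -/
lemma mlieBracket_leftField_rightField [FiniteDimensional ℝ E] [T2Space G]
    (v w : GroupLieAlgebra 𝓘(ℝ, E) G) (x : G) :
    mlieBracket 𝓘(ℝ, E) (mulInvariantVectorField v) (rightField w) x = 0 := by
  have := FiniteDimensional.complete ℝ E
  by_contra hne
  obtain ⟨l, hl⟩ : ∃ l : E →L[ℝ] ℝ, l (mlieBracket 𝓘(ℝ, E) (mulInvariantVectorField v)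
      (rightField w) x) ≠ 0 := by
    by_contra! h
    exact hne ((SeparatingDual.eq_zero_iff_forall_dual_eq_zero (R := ℝ) (V := E) _).2 h)
  obtain ⟨h, hh, hd⟩ := exists_contMDiff_mvfderiv_eq x l
  apply hl
  have := mvfderiv_mlieBracket hh.contMDiffAt
    ((isSmoothField_leftField v).mdifferentiableAt (by simp) (x := x))
    ((isSmoothField_rightField w).mdifferentiableAt (by simp) (x := x))
  rw [leftField_rightField_comm hh, sub_self, hd] at this
  exact this

end InvariantFields

/-- The metric at the identity is only a bilinear form and need not match the norm of `E`; a local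
inner product structure built from it makes `stdOrthonormalBasis` applicable. -/
lemma exists_orthonormal_family {V : Type*} [AddCommGroup V] [Module ℝ V] [FiniteDimensional ℝ V]
    (B : V →ₗ[ℝ] V →ₗ[ℝ] ℝ) (hB : ∀ u w, B u w = B w u) (hpos : ∀ u, u ≠ 0 → 0 < B u u) :
    ∃ v : Fin (Module.finrank ℝ V) → V, ∀ i j, B (v i) (v j) = if i = j then 1 else 0 := by
  let C : InnerProductSpace.Core ℝ V :=
  { inner u w := B u w
    conj_inner_symm u w := by simp [hB u w]
    re_inner_nonneg u := by
      rcases eq_or_ne u 0 with rfl | hu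
      · simp
      · simpa using (hpos u hu).le
    add_left := by simp
    smul_left := by simp
    definite u hu := by contrapose! hu; exact (hpos u hu).ne' }
  let : NormedAddCommGroup V := C.toNormedAddCommGroup
  let : InnerProductSpace ℝ V := .ofCore C.toCore
  let b := stdOrthonormalBasis ℝ V
  exact ⟨b, fun i j ↦ orthonormal_iff_ite.1 b.orthonormal i j⟩

/-! ### Left-invariant orthonormal frames and their Levi-Civita connection -/

section Frame

open VectorField

variable {E : Type*} [NormedAddCommGroup E] [NormedSpace ℝ E]
  {G : Type*} [TopologicalSpace G] [ChartedSpace E G] [Group G]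

/-- The left-invariant vector field with value `u` at the identity. -/
abbrev leftField (u : GroupLieAlgebra 𝓘(ℝ, E) G) (x : G) : TangentSpace 𝓘(ℝ, E) x :=
  mulInvariantVectorField u x

lemma leftField_add (u w : GroupLieAlgebra 𝓘(ℝ, E) G) :
    leftField (u + w) = leftField u + leftField w :=
  funext fun x ↦ map_add (mfderiv 𝓘(ℝ, E) 𝓘(ℝ, E) (fun y : G ↦ x * y) 1) u w

lemma leftField_smul (a : ℝ) (u : GroupLieAlgebra 𝓘(ℝ, E) G) :
    leftField (a • u) = a • leftField u :=
  funext fun x ↦ map_smul (mfderiv 𝓘(ℝ, E) 𝓘(ℝ, E) (fun y : G ↦ x * y) 1) a u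

lemma leftField_sum {ι : Type*} (s : Finset ι) (a : ι → ℝ) (v : ι → GroupLieAlgebra 𝓘(ℝ, E) G)
    (x : G) : leftField (∑ i ∈ s, a i • v i) x = ∑ i ∈ s, a i • leftField (v i) x :=
  (map_sum (mfderiv 𝓘(ℝ, E) 𝓘(ℝ, E) (fun y : G ↦ x * y) 1) _ s).trans
    (Finset.sum_congr rfl fun i _ ↦
      map_smul (mfderiv 𝓘(ℝ, E) 𝓘(ℝ, E) (fun y : G ↦ x * y) 1) (a i) (v i))

lemma leftField_one (u : GroupLieAlgebra 𝓘(ℝ, E) G) : leftField u 1 = u := by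
  have : (fun y : G ↦ 1 * y) = id := funext one_mul
  change mfderiv 𝓘(ℝ, E) 𝓘(ℝ, E) (fun y : G ↦ 1 * y) 1 u = u
  rw [this, mfderiv_id]
  rfl

variable [LieGroup 𝓘(ℝ, E) ∞ G]

lemma leftField_mdifferentiableAt (u : GroupLieAlgebra 𝓘(ℝ, E) G) (x : G) :
    MDiffAt (T% (leftField u)) x :=
  (isSmoothField_leftField u).mdifferentiableAt (by simp)

variable (g : Metric 𝓘(ℝ, E) G)

lemma inner_leftField (hg : IsLeftInvariantMetric g) (u w : GroupLieAlgebra 𝓘(ℝ, E) G) (x : G) :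
    g.inner x (leftField u x) (leftField w x) = g.inner 1 u w := by
  have h := hg x 1 u w
  have h2 : ∀ y, y = x → g.inner y (show E from leftField u x) (show E from leftField w x)
      = g.inner x (leftField u x) (leftField w x) := by rintro _ rfl; rfl
  rw [← h, ← h2 _ (mul_one x)]
  rfl

/-- The structure constants of the Lie algebra in an orthonormal frame. -/
def structConst {ι : Type*} (v : ι → GroupLieAlgebra 𝓘(ℝ, E) G) (i j k : ι) : ℝ :=
  g.inner 1 ⁅v i, v j⁆ (v k)

lemma structConst_swap {ι : Type*} (v : ι → GroupLieAlgebra 𝓘(ℝ, E) G) (i j k : ι) :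
    structConst g v i j k = -structConst g v j i k := by
  rw [structConst, structConst, GroupLieAlgebra.bracket_def, mlieBracket_swap_apply, map_neg]
  rfl

variable [FiniteDimensional ℝ E]

lemma mlieBracket_leftField (u w : GroupLieAlgebra 𝓘(ℝ, E) G) :
    mlieBracket 𝓘(ℝ, E) (leftField u) (leftField w) = leftField ⁅u, w⁆ := by
  have := FiniteDimensional.complete ℝ E
  have : LieGroup 𝓘(ℝ, E) (minSmoothness ℝ 3) G := .of_le (n := ∞) (by
    simpa using ENat.LEInfty.out)
  exact (mulInvariantVector_mlieBracket u w).symm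

variable {ι : Type*} [Fintype ι] [DecidableEq ι]

/-- An orthonormal basis of the Lie algebra, with respect to the metric at the identity. -/
structure IsOrthonormalFrame (v : ι → GroupLieAlgebra 𝓘(ℝ, E) G) : Prop where
  invariant : IsLeftInvariantMetric g
  inner_eq : ∀ i j, g.inner 1 (v i) (v j) = if i = j then 1 else 0
  card_eq : Fintype.card ι = Module.finrank ℝ E

lemma exists_isOrthonormalFrame (hg : IsLeftInvariantMetric g) :
    ∃ v : Fin (Module.finrank ℝ E) → GroupLieAlgebra 𝓘(ℝ, E) G, IsOrthonormalFrame g v := by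
  have : FiniteDimensional ℝ (GroupLieAlgebra 𝓘(ℝ, E) G) :=
    inferInstanceAs (FiniteDimensional ℝ E)
  obtain ⟨v, hv⟩ := exists_orthonormal_family (V := GroupLieAlgebra 𝓘(ℝ, E) G)
    ((ContinuousLinearMap.coeLM ℝ).comp (g.inner (1 : G)).toLinearMap) (g.symm 1) (g.pos 1)
  exact ⟨v, hg, hv, Fintype.card_fin _⟩

namespace IsOrthonormalFrame

variable {g} {v : ι → GroupLieAlgebra 𝓘(ℝ, E) G}

lemma pair_eq (hv : IsOrthonormalFrame g v) (i j : ι) : pair g (leftField (v i)) (leftField (v j)) =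
    fun _ ↦ if i = j then 1 else 0 :=
  funext fun x ↦ (inner_leftField g hv.invariant _ _ x).trans (hv.inner_eq i j)

lemma exists_basis (hv : IsOrthonormalFrame g v) (x : G) : ∃ b : Module.Basis ι ℝ (TangentSpace 𝓘(ℝ, E) x),
    (∀ i, b i = leftField (v i) x) ∧ ∀ i u, b.coord i u = g.inner x u (leftField (v i) x) := by
  have hfd : FiniteDimensional ℝ (TangentSpace 𝓘(ℝ, E) x) :=
    inferInstanceAs (FiniteDimensional ℝ E)
  have hin : ∀ i j, g.inner x (leftField (v i) x) (leftField (v j) x) = if i = j then 1 else 0 :=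
    fun i j ↦ congrFun (hv.pair_eq i j) x
  have hli : LinearIndependent ℝ fun i ↦ leftField (v i) x := by
    rw [Fintype.linearIndependent_iff]
    intro a ha j
    have := congrArg (fun u ↦ g.inner x u (leftField (v j) x)) ha
    simpa [map_sum, hin] using this
  let b := basisOfLinearIndependentOfCardEqFinrank' _ hli hv.card_eq
  have hb : ∀ i, b i = leftField (v i) x :=
    congrFun (coe_basisOfLinearIndependentOfCardEqFinrank' _ hli hv.card_eq)
  refine ⟨b, hb, fun i u ↦ ?_⟩
  conv_rhs => rw [← b.sum_repr u]
  simp [map_sum, hb, hin]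

lemma sum_inner_smul (hv : IsOrthonormalFrame g v) (x : G) (u : TangentSpace 𝓘(ℝ, E) x) :
    ∑ i, g.inner x u (leftField (v i) x) • leftField (v i) x = u := by
  obtain ⟨b, hb, hc⟩ := hv.exists_basis x
  simpa [hb, ← hc] using b.sum_repr u

lemma inner_eq_sum (hv : IsOrthonormalFrame g v) (x : G) (u w : TangentSpace 𝓘(ℝ, E) x) :
    g.inner x u w = ∑ i, g.inner x u (leftField (v i) x) * g.inner x w (leftField (v i) x) := by
  conv_lhs => rw [← hv.sum_inner_smul x w]
  simp [map_sum, mul_comm]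

lemma sum_structConst_smul (hv : IsOrthonormalFrame g v) (i j : ι) : ∑ k, structConst g v i j k • v k = ⁅v i, v j⁆ := by
  refine Eq.trans (Finset.sum_congr rfl fun k _ ↦ ?_) (hv.sum_inner_smul 1 ⁅v i, v j⁆)
  rw [leftField_one, structConst]

lemma inner_mlieBracket (hv : IsOrthonormalFrame g v) (i j k : ι) (x : G) : g.inner x
    (mlieBracket 𝓘(ℝ, E) (leftField (v i)) (leftField (v j)) x) (leftField (v k) x) =
      structConst g v i j k := by
  rw [mlieBracket_leftField, inner_leftField g hv.invariant, structConst]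

lemma structConst_jacobi (hv : IsOrthonormalFrame g v) (i j k m : ι) : ∑ l, (structConst g v i j l * structConst g v l k m
    + structConst g v j k l * structConst g v l i m
    + structConst g v k i l * structConst g v l j m) = 0 := by
  have := FiniteDimensional.complete ℝ E
  have : LieGroup 𝓘(ℝ, E) (minSmoothness ℝ 3) G := .of_le (n := ∞) (by
    simpa using ENat.LEInfty.out)
  have h : ∀ i j k, ∑ l, structConst g v i j l * structConst g v l k m =
      g.inner 1 ⁅⁅v i, v j⁆, v k⁆ (v m) := fun i j k ↦ by
    rw [← hv.sum_structConst_smul i j, sum_lie]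
    simp only [smul_lie, map_sum, map_smul, sum_apply, smul_apply]
    rfl
  have hj : ⁅⁅v i, v j⁆, v k⁆ + ⁅⁅v j, v k⁆, v i⁆ + ⁅⁅v k, v i⁆, v j⁆ = 0 := by
    rw [← lie_skew ⁅v i, v j⁆ (v k), ← lie_skew ⁅v j, v k⁆ (v i), ← lie_skew ⁅v k, v i⁆ (v j), ← neg_add,
      ← neg_add, neg_eq_zero, ← lie_jacobi (v k) (v i) (v j)]
  rw [Finset.sum_add_distrib, Finset.sum_add_distrib, h, h, h, ← add_apply, ← map_add,
    ← add_apply, ← map_add, hj, map_zero, zero_apply]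

lemma mvfderiv_pair (hv : IsOrthonormalFrame g v) (i j : ι) (x : G) :
    mvfderiv 𝓘(ℝ, E) (pair g (leftField (v i)) (leftField (v j))) x = 0 := by
  rw [hv.pair_eq, mvfderiv_const]

lemma inner_leviCivita (hv : IsOrthonormalFrame g v) (i j k : ι) (x : G) : g.inner x
    (leviCivita g (leftField (v j)) x (leftField (v i) x)) (leftField (v k) x) =
      frameChristoffel (structConst g v) i j k := by
  refine (inner_leviCivitaAux g (leftField_mdifferentiableAt _ x)
    (leftField_mdifferentiableAt _ x) (leftField_mdifferentiableAt _ x)).trans ?_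
  simp only [koszul, hv.mvfderiv_pair, hv.inner_mlieBracket, frameChristoffel]
  simp
  ring

lemma leviCivita_apply (hv : IsOrthonormalFrame g v) (j : ι) (x : G) (u : TangentSpace 𝓘(ℝ, E) x) :
    leviCivita g (leftField (v j)) x u = ∑ k, (∑ i, g.inner x u (leftField (v i) x) *
      frameChristoffel (structConst g v) i j k) • leftField (v k) x := by
  conv_lhs => rw [← hv.sum_inner_smul x (leviCivita g (leftField (v j)) x u)]
  refine Finset.sum_congr rfl fun k _ ↦ ?_
  congr 1
  conv_lhs => rw [← hv.sum_inner_smul x u]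
  simp [map_sum, hv.inner_leviCivita]

end IsOrthonormalFrame

end Frame

/-! ### The Lie derivative of the metric as a tensor -/

section Riemannian

open VectorField

variable {E : Type*} [NormedAddCommGroup E] [NormedSpace ℝ E]
  {H : Type*} [TopologicalSpace H] {I : ModelWithCorners ℝ E H}
  {M : Type*} [TopologicalSpace M] [ChartedSpace H M] [IsManifold I ∞ M] (g : Metric I M)

lemma contMDiff_pair {Y Z : Π x : M, TangentSpace I x} (hY : IsSmoothField I Y)
    (hZ : IsSmoothField I Z) : ContMDiff I 𝓘(ℝ, ℝ) ∞ (pair g Y Z) := by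
  have : ContMDiff I (I.prod 𝓘(ℝ)) ∞
      (fun m ↦ Bundle.TotalSpace.mk' ℝ (E := Bundle.Trivial M ℝ) m (g.inner m (Y m) (Z m))) := by
    apply ContMDiff.clm_bundle_apply₂ (F₁ := E) (F₂ := E) (b := id)
    · exact g.contMDiff
    · exact hY
    · exact hZ
  exact fun x ↦ (Bundle.contMDiffAt_totalSpace.1 (this x)).2

lemma lieDerivMetric_comm (X Y Z : Π x : M, TangentSpace I x) (x : M) :
    lieDerivMetric g X Y Z x = lieDerivMetric g X Z Y x := by
  rw [lieDerivMetric, lieDerivMetric, pair_comm g Y Z, g.symm x (Y x), g.symm x (Z x)]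
  ring

variable [FiniteDimensional ℝ E]

lemma lieDerivMetric_tensorial_left {x : M} {X Z : Π x : M, TangentSpace I x}
    (hZ : MDiffAt (T% Z) x) :
    TensorialAt I E (fun Y ↦ lieDerivMetric g X Y Z x) x where
  smul {f Y} hf hY := by
    have := FiniteDimensional.complete ℝ E
    simp only [lieDerivMetric, pair_smul_left, mvfderiv_mul hf (mdifferentiableAt_pair g hY hZ),
      mlieBracket_smul_right hf hY]
    simp [pair]
    ring
  add {Y Y'} hY hY' := by
    have := FiniteDimensional.complete ℝ E
    simp only [lieDerivMetric, pair_add_left, mvfderiv_add (mdifferentiableAt_pair g hY hZ)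
      (mdifferentiableAt_pair g hY' hZ), mlieBracket_add_right hY hY']
    simp
    ring

lemma lieDerivMetric_tensorial_right {x : M} {X Y : Π x : M, TangentSpace I x}
    (hY : MDiffAt (T% Y) x) :
    TensorialAt I E (fun Z ↦ lieDerivMetric g X Y Z x) x := by
  simpa only [lieDerivMetric_comm g X Y] using lieDerivMetric_tensorial_left g (X := X) hY

/-- The Lie derivative of the metric in terms of the Levi-Civita connection. -/
lemma lieDerivMetric_eq_leviCivita {x : M} {X Y Z : Π x : M, TangentSpace I x}
    (hX : MDiffAt (T% X) x) (hY : MDiffAt (T% Y) x) (hZ : MDiffAt (T% Z) x) :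
    lieDerivMetric g X Y Z x = g.inner x (leviCivita g X x (Y x)) (Z x)
      + g.inner x (Y x) (leviCivita g X x (Z x)) := by
  rw [lieDerivMetric, leviCivita_metric g hX hY hZ, ← leviCivita_torsion g hX hY,
    ← leviCivita_torsion g hX hZ]
  simp

lemma leviCivita_add {x : M} {Y Y' : Π x : M, TangentSpace I x} (hY : MDiffAt (T% Y) x)
    (hY' : MDiffAt (T% Y') x) : leviCivita g (Y + Y') x = leviCivita g Y x + leviCivita g Y' x :=
  (leviCivita g).isCovariantDerivativeOnUniv.add hY hY'

lemma leviCivita_smul {x : M} {Y : Π x : M, TangentSpace I x} {f : M → ℝ}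
    (hf : MDifferentiableAt I 𝓘(ℝ, ℝ) f x) (hY : MDiffAt (T% Y) x) (u : TangentSpace I x) :
    leviCivita g (f • Y) x u = f x • leviCivita g Y x u + mvfderiv I f x u • Y x := by
  have := congrArg (fun A ↦ A u) ((leviCivita g).isCovariantDerivativeOnUniv.leibniz hY hf)
  simpa using this

end Riemannian

/-! ### Haar measure on a compact group -/

section Haar

open MeasureTheory MeasureTheory.Measure

/-- Haar measures on compact groups are right-invariant. -/
lemma isMulRightInvariant_of_compactSpace {G : Type*} [Group G] [TopologicalSpace G]
    [IsTopologicalGroup G] [CompactSpace G] [MeasurableSpace G] [BorelSpace G]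
    (μ : Measure G) [μ.IsHaarMeasure] : μ.IsMulRightInvariant where
  map_mul_right_eq_self a := by
    have h := map_right_mul_eq_modularCharacterFun_smul μ a
    -- Compare total masses: right translation preserves the mass of the whole group, which is
    -- finite and nonzero, so the modular factor is 1.
    have h2 := congrArg (fun ν ↦ ν Set.univ) h
    simp only [map_apply (measurable_mul_const a) MeasurableSet.univ, Set.preimage_univ] at h2
    have h3 : (modularCharacterFun a : ENNReal) * μ Set.univ = 1 * μ Set.univ := by
      rw [one_mul]; exact h2.symm
    rw [ENNReal.mul_left_inj (NeZero.ne _) (measure_ne_top _ _), ENNReal.coe_eq_one] at h3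
    rw [h, h3, one_smul]

end Haar

lemma leviCivita_leftField_sum {E : Type*} [NormedAddCommGroup E] [NormedSpace ℝ E]
    [FiniteDimensional ℝ E] {G : Type*} [TopologicalSpace G] [ChartedSpace E G] [Group G]
    [LieGroup 𝓘(ℝ, E) ∞ G] (g : Metric 𝓘(ℝ, E) G) {ι : Type*} (s : Finset ι) (a : ι → ℝ)
    (v : ι → GroupLieAlgebra 𝓘(ℝ, E) G) (x : G) :
    leviCivita g (leftField (∑ i ∈ s, a i • v i)) x =
      ∑ i ∈ s, a i • leviCivita g (leftField (v i)) x := by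
  let L : GroupLieAlgebra 𝓘(ℝ, E) G →ₗ[ℝ] (TangentSpace 𝓘(ℝ, E) x →L[ℝ] TangentSpace 𝓘(ℝ, E) x) :=
  { toFun w := leviCivita g (leftField w) x
    map_add' u w := by
      rw [leftField_add, leviCivita_add g (leftField_mdifferentiableAt u x)
        (leftField_mdifferentiableAt w x)]
    map_smul' a u := by
      rw [leftField_smul]
      exact (leviCivita g).isCovariantDerivativeOnUniv.smul_const a
        (leftField_mdifferentiableAt u x) }
  exact (map_sum L (fun i ↦ a i • v i) s).trans
    (Finset.sum_congr rfl fun i _ ↦ map_smul L (a i) (v i))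

lemma rightField_one {E : Type*} [NormedAddCommGroup E] [NormedSpace ℝ E] {G : Type*}
    [TopologicalSpace G] [ChartedSpace E G] [Group G] (w : GroupLieAlgebra 𝓘(ℝ, E) G) :
    rightField w 1 = w := by
  have : (fun y : G ↦ y * 1) = id := funext mul_one
  change mfderiv 𝓘(ℝ, E) 𝓘(ℝ, E) (fun y : G ↦ y * 1) 1 w = w
  rw [this, mfderiv_id]
  rfl

/-! ### Unimodularity and Ricci curvature in the frame -/

namespace IsOrthonormalFrame

open VectorField

variable {E : Type*} [NormedAddCommGroup E] [NormedSpace ℝ E] [FiniteDimensional ℝ E]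
  {G : Type*} [TopologicalSpace G] [ChartedSpace E G] [Group G] [LieGroup 𝓘(ℝ, E) ∞ G]
  {ι : Type*} [Fintype ι] [DecidableEq ι] {g : Metric 𝓘(ℝ, E) G}
  {v : ι → GroupLieAlgebra 𝓘(ℝ, E) G}

/-- The derivative of a component of a vector field in an orthonormal frame. -/
lemma mvfderiv_pair_leftField (hv : IsOrthonormalFrame g v) {X : Π x : G, TangentSpace 𝓘(ℝ, E) x}
    {x : G} (hX : MDiffAt (T% X) x) (i j : ι) :
    mvfderiv 𝓘(ℝ, E) (pair g X (leftField (v j))) x (leftField (v i) x) =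
      g.inner x (leviCivita g X x (leftField (v i) x)) (leftField (v j) x)
        + ∑ k, pair g X (leftField (v k)) x * frameChristoffel (structConst g v) i j k := by
  rw [leviCivita_metric g (leftField_mdifferentiableAt _ x) hX (leftField_mdifferentiableAt _ x),
    hv.inner_eq_sum x (X x)]
  congr 1
  exact Finset.sum_congr rfl fun k _ ↦ by rw [hv.inner_leviCivita]; rfl

/-- The Lie derivative of the metric in an orthonormal frame. -/
lemma lieDerivMetric_leftField (hv : IsOrthonormalFrame g v)
    {X : Π x : G, TangentSpace 𝓘(ℝ, E) x} {x : G} (hX : MDiffAt (T% X) x) (i j : ι) :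
    lieDerivMetric g X (leftField (v i)) (leftField (v j)) x =
      mvfderiv 𝓘(ℝ, E) (pair g X (leftField (v j))) x (leftField (v i) x)
        + mvfderiv 𝓘(ℝ, E) (pair g X (leftField (v i))) x (leftField (v j) x)
        - ∑ k, pair g X (leftField (v k)) x * (structConst g v k i j + structConst g v k j i) := by
  rw [lieDerivMetric_eq_leviCivita g hX (leftField_mdifferentiableAt _ x)
    (leftField_mdifferentiableAt _ x), hv.mvfderiv_pair_leftField hX,
    hv.mvfderiv_pair_leftField hX, g.symm x (leftField (v i) x)]
  -- In `Γ_ijk + Γ_jik` the torsion parts `c_ijk` and `c_jik` cancel.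
  have : ∑ k, pair g X (leftField (v k)) x * (structConst g v k i j + structConst g v k j i) =
      ∑ k, pair g X (leftField (v k)) x * frameChristoffel (structConst g v) i j k +
      ∑ k, pair g X (leftField (v k)) x * frameChristoffel (structConst g v) j i k := by
    rw [← Finset.sum_add_distrib]
    refine Finset.sum_congr rfl fun k _ ↦ ?_
    rw [frameChristoffel, frameChristoffel, structConst_swap g v j i k, structConst_swap g v k i j,
      structConst_swap g v k j i]
    ring
  rw [this]
  ring

/-- The Lie algebra of a compact group is unimodular. -/
lemma sum_structConst_eq_zero [T2Space G] [CompactSpace G] (hv : IsOrthonormalFrame g v) (i : ι) :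
    ∑ k, structConst g v i k k = 0 := by
  have : IsTopologicalGroup G := topologicalGroup_of_lieGroup 𝓘(ℝ, E) ∞
  let : MeasurableSpace G := borel G
  have : BorelSpace G := ⟨rfl⟩
  let μ : MeasureTheory.Measure G := MeasureTheory.Measure.haar
  have : μ.IsMulRightInvariant := isMulRightInvariant_of_compactSpace μ
  -- With `T = tr ad` of the frame components of `R`, the proof shows `∫ T² = 0`. Then `T` vanishes
  -- at the identity, where `R` equals `v i`.
  set R : Π x : G, TangentSpace 𝓘(ℝ, E) x := rightField (v i)
  have hR : IsSmoothField 𝓘(ℝ, E) R := isSmoothField_rightField (v i)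
  have hRd : ∀ x, MDiffAt (T% R) x := fun x ↦ hR.mdifferentiableAt (by simp)
  let N : ι → G → ℝ := fun j ↦ pair g R (leftField (v j))
  have hN : ∀ j, ContMDiff 𝓘(ℝ, E) 𝓘(ℝ, ℝ) ∞ (N j) := fun j ↦
    contMDiff_pair g hR (isSmoothField_leftField _)
  -- This is `[e_k, R] = 0` written in components, with `R = ∑ N_j e_j`.
  have hdN : ∀ x k l, mvfderiv 𝓘(ℝ, E) (N l) x (leftField (v k) x) =
      -∑ j, N j x * structConst g v k j l := fun x k l ↦ by
    have ht := leviCivita_torsion g (leftField_mdifferentiableAt (v k) x) (hRd x)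
    rw [mlieBracket_leftField_rightField, sub_eq_zero] at ht
    rw [hv.mvfderiv_pair_leftField (hRd x), ht, hv.leviCivita_apply, ← Finset.sum_neg_distrib]
    have h1 : ∀ j, g.inner x (leftField (v j) x) (leftField (v l) x) = if j = l then 1 else 0 :=
      fun j ↦ congrFun (hv.pair_eq j l) x
    simp only [map_sum, map_smul, sum_apply, smul_apply, h1, smul_eq_mul, mul_ite, mul_one,
      mul_zero, Finset.sum_ite_eq', Finset.mem_univ, if_true]
    rw [← Finset.sum_add_distrib]
    refine Finset.sum_congr rfl fun j _ ↦ ?_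
    change N j x * _ + N j x * _ = _
    rw [frameChristoffel, frameChristoffel, structConst_swap g v j k, structConst_swap g v j l,
      structConst_swap g v k l]
    ring
  let T : G → ℝ := fun x ↦ ∑ k, N k x * ∑ j, structConst g v k j j
  have hT : ContMDiff 𝓘(ℝ, E) 𝓘(ℝ, ℝ) ∞ T :=
    contMDiff_finsetSum fun k _ ↦ (hN k).mul contMDiff_const
  have hdiv : ∀ x, ∑ j, mvfderiv 𝓘(ℝ, E) (N j) x (leftField (v j) x) = T x := fun x ↦ by
    simp only [hdN, T, ← Finset.sum_neg_distrib, Finset.mul_sum]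
    rw [Finset.sum_comm]
    exact Finset.sum_congr rfl fun k _ ↦ Finset.sum_congr rfl fun j _ ↦ by
      rw [structConst_swap g v k]; ring
  -- The product rule with `T = ∑ e_j(N_j)`. Right-invariance of Haar measure kills the integral of
  -- the first part, left-invariance that of `R(T)`.
  have hRT : ∀ x, T x * T x = ∑ j, mvfderiv 𝓘(ℝ, E) (N j * T) x (leftField (v j) x)
      - mvfderiv 𝓘(ℝ, E) T x (R x) := fun x ↦ by
    have hTx := hT.mdifferentiableAt (by simp) (x := x)
    have h1 : mvfderiv 𝓘(ℝ, E) T x (R x) =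
        ∑ j, N j x * mvfderiv 𝓘(ℝ, E) T x (leftField (v j) x) := by
      conv_lhs => rw [← hv.sum_inner_smul x (R x)]
      simp [map_sum, N, pair]
    rw [h1, ← Finset.sum_sub_distrib, ← hdiv, Finset.sum_mul]
    refine Finset.sum_congr rfl fun j _ ↦ ?_
    rw [mvfderiv_mul ((hN j).mdifferentiableAt (by simp)) hTx, hdiv]
    simp
    ring
  have hc : ∀ {h : G → ℝ}, ContMDiff 𝓘(ℝ, E) 𝓘(ℝ, ℝ) ∞ h → MeasureTheory.Integrable h μ :=
    fun hh ↦ hh.continuous.integrable_of_hasCompactSupport (HasCompactSupport.of_compactSpace _)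
  have hint : ∫ x, T x * T x ∂μ = 0 := by
    simp only [hRT]
    rw [MeasureTheory.integral_sub, integral_rightField μ hT,
      MeasureTheory.integral_finsetSum _ fun j _ ↦
        hc (contMDiff_mvfderiv_apply ((hN j).mul hT) (isSmoothField_leftField _)), sub_zero]
    · exact Finset.sum_eq_zero fun j _ ↦ integral_leftField μ ((hN j).mul hT) _
    · exact MeasureTheory.integrable_finsetSum _ fun j _ ↦
        hc (contMDiff_mvfderiv_apply ((hN j).mul hT) (isSmoothField_leftField _))
    · exact hc (contMDiff_mvfderiv_apply hT hR)
  have hTT : Continuous fun x ↦ T x * T x := hT.continuous.mul hT.continuous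
  have h0 := (hTT.ae_eq_iff_eq μ continuous_const).1
    ((MeasureTheory.integral_eq_zero_iff_of_nonneg (fun x ↦ mul_self_nonneg (T x))
      (hc (hT.mul hT))).1 hint)
  have h1 : T 1 = 0 := mul_self_eq_zero.1 (congrFun h0 1)
  have h2 : ∀ k, N k 1 = if i = k then 1 else 0 := fun k ↦ by
    change g.inner 1 (rightField (v i) 1) (leftField (v k) 1) = _
    rw [rightField_one, leftField_one, hv.inner_eq]
  simpa [T, h2] using h1

/-- `ricci` inserts local extensions of tangent vectors in the first slot; tensoriality lets frame
fields replace them. The differentiability it requires of `∇_V e_b` holds because the Christoffel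
symbols are constant. -/
lemma curvature_tensorial (hv : IsOrthonormalFrame g v) (a b : ι) (x : G) :
    TensorialAt 𝓘(ℝ, E) E
      (fun V ↦ curvature g V (leftField (v a)) (leftField (v b)) x) x := by
  have := FiniteDimensional.complete ℝ E
  have hW : ∀ {V : Π x : G, TangentSpace 𝓘(ℝ, E) x}, MDiffAt (T% V) x →
      MDiffAt (T% (fun y ↦ leviCivita g (leftField (v b)) y (V y))) x := fun {V} hV ↦ by
    simp only [hv.leviCivita_apply]
    refine .sum_section fun k _ ↦ .smul_section ?_ (leftField_mdifferentiableAt _ x)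
    have h1 : (fun y ↦ ∑ i, g.inner y (V y) (leftField (v i) y) *
        frameChristoffel (structConst g v) i b k) = ∑ i, pair g V (leftField (v i)) *
          fun _ ↦ frameChristoffel (structConst g v) i b k := by
      ext y
      simp [pair]
    rw [h1]
    refine Finset.sum_induction _ (fun f : G → ℝ ↦ MDifferentiableAt 𝓘(ℝ, E) 𝓘(ℝ, ℝ) f x)
      (fun _ _ hf hf' ↦ hf.add hf') (mdifferentiableAt_const (c := (0 : ℝ))) fun i _ ↦ ?_
    exact (mdifferentiableAt_pair g hV (leftField_mdifferentiableAt (v i) x)).mul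
      mdifferentiableAt_const
  constructor
  · intro f V hf hV
    have h1 : (fun y ↦ leviCivita g (leftField (v b)) y ((f • V) y)) =
        f • fun y ↦ leviCivita g (leftField (v b)) y (V y) := by
      ext y
      simp
    simp only [curvature, h1, mlieBracket_smul_left hf hV, leviCivita_smul g hf (hW hV)]
    simp
    module
  · intro V V' hV hV'
    have h1 : (fun y ↦ leviCivita g (leftField (v b)) y ((V + V') y)) =
        (fun y ↦ leviCivita g (leftField (v b)) y (V y)) +
          fun y ↦ leviCivita g (leftField (v b)) y (V' y) := by
      ext y
      simp
    simp only [curvature, h1, mlieBracket_add_left hV hV', leviCivita_add g (hW hV) (hW hV')]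
    simp
    abel

lemma inner_curvature (hv : IsOrthonormalFrame g v) (a b k : ι) (x : G) :
    g.inner x (curvature g (leftField (v k)) (leftField (v a)) (leftField (v b)) x)
      (leftField (v k) x) = ∑ l,
      (frameChristoffel (structConst g v) a b l * frameChristoffel (structConst g v) k l k
      - frameChristoffel (structConst g v) k b l * frameChristoffel (structConst g v) a l k
      - structConst g v k a l * frameChristoffel (structConst g v) l b k) := by
  -- `∇_{e_a} e_b` is again left-invariant, so a second covariant derivative is purely algebraic.
  have h1 : ∀ a, (fun y ↦ leviCivita g (leftField (v b)) y (leftField (v a) y)) =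
      leftField (∑ l, frameChristoffel (structConst g v) a b l • v l) := fun a ↦ by
    ext y
    rw [hv.leviCivita_apply, leftField_sum]
    refine Finset.sum_congr rfl fun l _ ↦ ?_
    have : ∀ i, g.inner y (leftField (v a) y) (leftField (v i) y) = if a = i then 1 else 0 :=
      fun i ↦ congrFun (hv.pair_eq a i) y
    simp [this]
  have h2 : ∀ c d : ι, g.inner x (leviCivita g
      (leftField (∑ l, frameChristoffel (structConst g v) c b l • v l)) x (leftField (v d) x))
      (leftField (v k) x) = ∑ l, frameChristoffel (structConst g v) c b l *
        frameChristoffel (structConst g v) d l k := fun c d ↦ by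
    rw [leviCivita_leftField_sum]
    simp [hv.inner_leviCivita]
  have h3 : g.inner x (leviCivita g (leftField (v b)) x
      (mlieBracket 𝓘(ℝ, E) (leftField (v k)) (leftField (v a)) x)) (leftField (v k) x) =
      ∑ l, structConst g v k a l * frameChristoffel (structConst g v) l b k := by
    conv_lhs => rw [← hv.sum_inner_smul x (mlieBracket 𝓘(ℝ, E) (leftField (v k)) _ x)]
    simp [hv.inner_mlieBracket, hv.inner_leviCivita]
  rw [curvature, h1, h1, map_sub, map_sub, sub_apply, sub_apply, h2, h2, h3,
    Finset.sum_sub_distrib, Finset.sum_sub_distrib]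

/-- The trace does not depend on the basis, so the arbitrary basis in `ricci` may be exchanged for
the orthonormal frame, whose coordinates are inner products. -/
lemma ricci_eq (hv : IsOrthonormalFrame g v) (a b : ι) (x : G) :
    ricci g (leftField (v a)) (leftField (v b)) x = frameRicci (structConst g v) a b := by
  have hfd : FiniteDimensional ℝ (TangentSpace 𝓘(ℝ, E) x) :=
    inferInstanceAs (FiniteDimensional ℝ E)
  let T := TensorialAt.mkHom _ x (hv.curvature_tensorial a b x)
  obtain ⟨e, he, hec⟩ := hv.exists_basis x
  have h1 : ∀ {κ : Type} [Fintype κ] [DecidableEq κ]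
      (b' : Module.Basis κ ℝ (TangentSpace 𝓘(ℝ, E) x)),
      ∑ i, b'.coord i (T (b' i)) = LinearMap.trace ℝ _ T.toLinearMap := fun b' ↦ by
    rw [LinearMap.trace_eq_matrix_trace ℝ b']
    simp [Matrix.trace, LinearMap.toMatrix_apply]
  have h2 : ∑ i, e.coord i (T (e i)) = LinearMap.trace ℝ _ T.toLinearMap := by
    rw [LinearMap.trace_eq_matrix_trace ℝ e]
    simp [Matrix.trace, LinearMap.toMatrix_apply]
  have h3 : ricci g (leftField (v a)) (leftField (v b)) x = LinearMap.trace ℝ _ T.toLinearMap := by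
    rw [← h1 (Module.finBasis ℝ (TangentSpace 𝓘(ℝ, E) x))]
    exact Finset.sum_congr rfl fun i _ ↦ by
      rw [TensorialAt.mkHom_apply_eq_extend]
  rw [h3, ← h2, frameRicci]
  refine Finset.sum_congr rfl fun k _ ↦ ?_
  rw [hec, he, ← hv.inner_curvature,
    TensorialAt.mkHom_apply (hv.curvature_tensorial a b x) (leftField_mdifferentiableAt (v k) x)]

end IsOrthonormalFrame

section Sum

variable {E : Type*} [NormedAddCommGroup E] [NormedSpace ℝ E]
  {H : Type*} [TopologicalSpace H] {I : ModelWithCorners ℝ E H}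
  {M : Type*} [TopologicalSpace M] [ChartedSpace H M]

lemma mvfderiv_finsetSum {ι : Type*} {f : ι → M → ℝ} {x : M} (s : Finset ι)
    (hf : ∀ i ∈ s, MDifferentiableAt I 𝓘(ℝ, ℝ) (f i) x) :
    mvfderiv I (∑ i ∈ s, f i) x = ∑ i ∈ s, mvfderiv I (f i) x := by
  suffices h : MDifferentiableAt I 𝓘(ℝ, ℝ) (∑ i ∈ s, f i) x ∧
      mvfderiv I (∑ i ∈ s, f i) x = ∑ i ∈ s, mvfderiv I (f i) x from h.2
  classical
  induction s using Finset.induction_on with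
  | empty => exact ⟨mdifferentiableAt_const (c := (0 : ℝ)), mvfderiv_zero⟩
  | insert i s hi ih =>
    obtain ⟨h1, h2⟩ := ih fun j hj ↦ hf j (Finset.mem_insert_of_mem hj)
    have hfi := hf i (Finset.mem_insert_self i s)
    rw [Finset.sum_insert hi, Finset.sum_insert hi]
    exact ⟨hfi.add h1, by rw [mvfderiv_add hfi h1, h2]⟩

end Sum

/-! ### Killing property and invariance -/

section Main

variable {E : Type*} [NormedAddCommGroup E] [NormedSpace ℝ E] [FiniteDimensional ℝ E]
  {G : Type*} [TopologicalSpace G] [ChartedSpace E G] [Group G] [LieGroup 𝓘(ℝ, E) ∞ G]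
  {ι : Type*} [Fintype ι] [DecidableEq ι] {g : Metric 𝓘(ℝ, E) G}
  {v : ι → GroupLieAlgebra 𝓘(ℝ, E) G} {m c : ℝ} {X : Π x : G, TangentSpace 𝓘(ℝ, E) x}

/-- The Lie derivative of a quasi-Einstein metric on a compact group vanishes on the fields of a
left-invariant orthonormal frame. -/
lemma IsOrthonormalFrame.lieDerivMetric_leftField_eq_zero [T2Space G] [CompactSpace G]
    (hv : IsOrthonormalFrame g v) (hm : m ≠ 0) (hX : IsSmoothField 𝓘(ℝ, E) X)
    (hqe : IsQuasiEinstein g m c X) (i j : ι) (x : G) :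
    lieDerivMetric g X (leftField (v i)) (leftField (v j)) x = 0 := by
  have : IsTopologicalGroup G := topologicalGroup_of_lieGroup 𝓘(ℝ, E) ∞
  let : MeasurableSpace G := borel G
  have : BorelSpace G := ⟨rfl⟩
  let μ : MeasureTheory.Measure G := MeasureTheory.Measure.haar
  have : μ.IsMulRightInvariant := isMulRightInvariant_of_compactSpace μ
  have hXd : ∀ x, MDiffAt (T% X) x := fun x ↦ hX.mdifferentiableAt (by simp)
  let f : ι → G → ℝ := fun i ↦ pair g X (leftField (v i))
  have hf : ∀ i, ContMDiff 𝓘(ℝ, E) 𝓘(ℝ, ℝ) ∞ (f i) := fun i ↦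
    contMDiff_pair g hX (isSmoothField_leftField _)
  have hfd : ∀ i x, MDifferentiableAt 𝓘(ℝ, E) 𝓘(ℝ, ℝ) (f i) x := fun i x ↦
    (hf i).mdifferentiableAt (by simp)
  let a : ι → ι → G → ℝ := fun i j x ↦ mvfderiv 𝓘(ℝ, E) (f j) x (leftField (v i) x)
  have ha : ∀ i j, ContMDiff 𝓘(ℝ, E) 𝓘(ℝ, ℝ) ∞ (a i j) := fun i j ↦
    contMDiff_mvfderiv_apply (hf j) (isSmoothField_leftField _)
  have hanti := structConst_swap g v
  have htr := hv.sum_structConst_eq_zero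
  have key := lieDeriv_frame_eq_zero μ (c := structConst g v) (r := frameRicci (structConst g v))
    (f := f) (a := a) (K := fun i j x ↦
      1 / 2 * lieDerivMetric g X (leftField (v i)) (leftField (v j)) x) (l := c) hm hanti htr
    (sum_frameRicci_mul_eq_zero hanti htr hv.structConst_jacobi)
    (fun i ↦ (hf i).continuous) (fun i j ↦ (ha i j).continuous)
    (fun i j x ↦ by rw [hv.lieDerivMetric_leftField (hXd x)]; ring)
    (fun i j x ↦ by
      have h := hqe (leftField (v i)) (leftField (v j)) (isSmoothField_leftField _)
        (isSmoothField_leftField _) x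
      rwa [hv.ricci_eq, hv.pair_eq] at h)
    (fun i j ↦ integral_leftField μ (hf j) (v i))
    (fun i ↦ by
      have hs : ContMDiff 𝓘(ℝ, E) 𝓘(ℝ, ℝ) ∞ (∑ j, f j * f j) :=
        contMDiff_finsetSum' fun j _ ↦ (hf j).mul (hf j)
      -- The integrand is `e_i(f_i |X|²)`, the `i`-th term of `div(|X|² X)`.
      rw [← integral_leftField μ ((hf i).mul hs) (v i)]
      congr 1
      ext x
      rw [mvfderiv_mul (hfd i x) (hs.mdifferentiableAt (by simp))]
      have h1 : mvfderiv 𝓘(ℝ, E) (∑ j, f j * f j) x (leftField (v i) x) =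
          2 * ∑ j, f j x * a i j x := by
        rw [mvfderiv_finsetSum _ fun j _ ↦ (hfd j x).mul (hfd j x), sum_apply,
          Finset.mul_sum]
        refine Finset.sum_congr rfl fun j _ ↦ ?_
        rw [mvfderiv_mul (hfd j x) (hfd j x)]
        simp [a]
        ring
      simp only [add_apply, smul_apply]
      rw [h1]
      simp [a]
      ring)
    i j x
  simpa using key

/-- A quasi-Einstein field on a compact group with a left-invariant metric is Killing. -/
lemma IsQuasiEinstein.isKilling [T2Space G] [CompactSpace G] (hg : IsLeftInvariantMetric g)
    (hm : m ≠ 0) (hX : IsSmoothField 𝓘(ℝ, E) X) (hqe : IsQuasiEinstein g m c X) :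
    IsKilling g X := by
  obtain ⟨v, hv⟩ := exists_isOrthonormalFrame g hg
  intro Y Z hY hZ x
  have hXd : MDiffAt (T% X) x := hX.mdifferentiableAt (by simp)
  -- The Lie derivative depends only on the values of `Y` and `Z` at `x`, so vanishing on the frame
  -- is enough.
  let B := TensorialAt.mkHom₂ (fun Y Z ↦ lieDerivMetric g X Y Z x) x
    (fun _ hZ ↦ lieDerivMetric_tensorial_left g hZ)
    (fun _ hY ↦ lieDerivMetric_tensorial_right g hY)
  have hB : ∀ {Y Z : Π x : G, TangentSpace 𝓘(ℝ, E) x}, MDiffAt (T% Y) x → MDiffAt (T% Z) x →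
      B (Y x) (Z x) = lieDerivMetric g X Y Z x := fun hY hZ ↦
    TensorialAt.mkHom₂_apply _ _ hY hZ
  rw [← hB (hY.mdifferentiableAt (by simp)) (hZ.mdifferentiableAt (by simp)),
    ← hv.sum_inner_smul x (Y x), ← hv.sum_inner_smul x (Z x)]
  have h0 : ∀ i j, B (leftField (v i) x) (leftField (v j) x) = 0 := fun i j ↦ by
    rw [hB (leftField_mdifferentiableAt _ x) (leftField_mdifferentiableAt _ x),
      hv.lieDerivMetric_leftField_eq_zero hm hX hqe]
  simp [map_sum, h0]

/-- The components of a quasi-Einstein field in a left-invariant frame are constant on connected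
sets. -/
lemma IsOrthonormalFrame.pair_leftField_eq [T2Space G] [CompactSpace G]
    (hv : IsOrthonormalFrame g v) (hm : m ≠ 0) (hX : IsSmoothField 𝓘(ℝ, E) X)
    (hqe : IsQuasiEinstein g m c X) (i : ι) {s : Set G} (hs : IsPreconnected s) {x y : G}
    (hx : x ∈ s) (hy : y ∈ s) :
    pair g X (leftField (v i)) x = pair g X (leftField (v i)) y := by
  set f := pair g X (leftField (v i)) with hf
  have hfc : Continuous f := (contMDiff_pair g hX (isSmoothField_leftField _)).continuous
  -- The `i`-th diagonal entry of the equation once the Lie derivative term is gone; its right side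
  -- does not depend on `z`.
  have hsq : ∀ z, f z ^ 2 = m * (frameRicci (structConst g v) i i - c) := fun z ↦ by
    have h := hqe (leftField (v i)) (leftField (v i)) (isSmoothField_leftField _)
        (isSmoothField_leftField _) z
    rw [hv.ricci_eq, hv.pair_eq, hv.lieDerivMetric_leftField_eq_zero hm hX hqe] at h
    simp only [← hf, if_true] at h
    field_simp at h
    linarith
  have h1 : Set.EqOn (f ^ 2) ((fun _ ↦ f x) ^ 2) s := fun z _ ↦ by
    simp [hsq]
  by_cases hfx : f x = 0
  · have := hsq y
    rw [← hsq x, hfx] at this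
    rw [hfx]
    exact (pow_eq_zero_iff two_ne_zero |>.1 (by simpa using this)).symm
  -- A continuous function with constant nonzero square cannot change sign on a preconnected set.
  · exact (hs.eq_of_sq_eq hfc.continuousOn continuousOn_const h1 (fun _ ↦ hfx) hx rfl hy).symm

/-- A quasi-Einstein field on a compact group with a left-invariant metric is invariant under the
left translations which preserve the connected components. -/
lemma IsQuasiEinstein.isInvariantUnderLeft [T2Space G] [CompactSpace G]
    (hg : IsLeftInvariantMetric g) (hm : m ≠ 0) (hX : IsSmoothField 𝓘(ℝ, E) X)
    (hqe : IsQuasiEinstein g m c X) {a : G} (ha : a ∈ connectedComponent (1 : G)) :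
    IsInvariantUnderLeft a X := by
  have : IsTopologicalGroup G := topologicalGroup_of_lieGroup 𝓘(ℝ, E) ∞
  obtain ⟨v, hv⟩ := exists_isOrthonormalFrame g hg
  intro x
  -- The right translate of the identity component by `x` is a connected set containing both `x` and
  -- `a * x`, so the frame components of `X` agree at these points.
  have hs : IsPreconnected ((fun y ↦ y * x) '' connectedComponent (1 : G)) :=
    isPreconnected_connectedComponent.image _ (by fun_prop)
  have hcomp : ∀ i, pair g X (leftField (v i)) x = pair g X (leftField (v i)) (a * x) := fun i ↦
    hv.pair_leftField_eq hm hX hqe i hs ⟨1, mem_connectedComponent, one_mul x⟩ ⟨a, ha, rfl⟩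
  have hlf : ∀ u : GroupLieAlgebra 𝓘(ℝ, E) G,
      mfderiv 𝓘(ℝ, E) 𝓘(ℝ, E) (fun y ↦ a * y) x (leftField u x) = leftField u (a * x) :=
      fun u ↦ by
    have hd : ∀ b y : G, MDifferentiableAt 𝓘(ℝ, E) 𝓘(ℝ, E) (fun z ↦ b * z) y := fun b y ↦
      (contMDiff_mul_left (I := 𝓘(ℝ, E)) (n := ∞)).mdifferentiableAt (by simp)
    have h1 := congrArg (fun A ↦ A u) (mfderiv_comp (I' := 𝓘(ℝ, E)) (1 : G) (hd a (x * 1)) (hd x 1))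
    have h2 : (fun z ↦ a * z) ∘ (fun z ↦ x * z) = fun z ↦ a * x * z :=
      funext fun z ↦ (mul_assoc a x z).symm
    have h3 : ∀ y, y = x → ∀ w : E, (show E from mfderiv 𝓘(ℝ, E) 𝓘(ℝ, E) (fun z ↦ a * z) y w)
        = mfderiv 𝓘(ℝ, E) 𝓘(ℝ, E) (fun z ↦ a * z) x w := by rintro _ rfl w; rfl
    rw [h2] at h1
    exact (h3 _ (mul_one x) _).symm.trans h1.symm
  rw [← hv.sum_inner_smul (a * x) (X (a * x)), ← hv.sum_inner_smul x (X x), map_sum]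
  refine Finset.sum_congr rfl fun i _ ↦ ?_
  rw [map_smul, hlf]
  congr 1
  exact hcomp i

end Main

end QuasiEinstein

end

theorem theorem1p1
    {E : Type*} [NormedAddCommGroup E] [NormedSpace ℝ E] [FiniteDimensional ℝ E]
    {G : Type*} [TopologicalSpace G] [ChartedSpace E G] [Group G] [LieGroup 𝓘(ℝ, E) ∞ G]
    [T2Space G] [CompactSpace G]
    (g : QuasiEinstein.Metric 𝓘(ℝ, E) G) (hg : QuasiEinstein.IsLeftInvariantMetric g)
    (m : ℝ) (hm : 0 < m) (c : ℝ)
    (X : Π x : G, TangentSpace 𝓘(ℝ, E) x) (hX : QuasiEinstein.IsSmoothField 𝓘(ℝ, E) X)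
    (hqe : QuasiEinstein.IsQuasiEinstein g m c X) :
    (ConnectedSpace G → QuasiEinstein.IsLeftInvariantField X) ∧
      (∀ a ∈ connectedComponent (1 : G), QuasiEinstein.IsInvariantUnderLeft a X) ∧
      QuasiEinstein.IsKilling g X :=
  ⟨fun _ _ ↦ hqe.isInvariantUnderLeft hg hm.ne' hX
      (by rw [PreconnectedSpace.connectedComponent_eq_univ]; trivial),
    fun _ ha ↦ hqe.isInvariantUnderLeft hg hm.ne' hX ha, hqe.isKilling hg hm.ne' hX⟩
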